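/- Notation. Let $\Delta\subset\mathbb C$ be the open unit disk with Poincaré distance $\omega(a,b)=\frac12\log\frac{1+\rho}{1-\rho}$, $\rho=\left|\frac{b-a}{1-\bar a b}\right|$, let $\|z\|_\infty=\max_j|z_j|$ on $\mathbb C^n$, let $\Delta^n=\{z\in\mathbb C^n:\|z\|_\infty<1\}$, and let $k_{\Delta^n}$ be the Kobayashi distance of $\Delta^n$, so that $k_{\Delta^n}(z,w)=\max_j\omega(z_j,w_j)$. Let $x\in\partial\Delta^n$. Put $d_x=\#\{j:|x_j|=1\}$; let $\check x_j=x_j$ if $|x_j|=1$ and $\check x_j=0$ if $|x_j|<1$; and put $\tilde p_x(z)=\frac1{d_x}\sum_j z_j\overline{\check x_j}$ and $p_x(z)=\tilde p_x(z)\,x$ (the canonical projection device at $x$). An $x$-curve is a continuous $\sigma\colon[0,1)\to\Delta^n$ with $\sigma(t)\to x$ as $t\to1^-$. It is special if $k_{\Delta^n}(\sigma(t),p_x(\sigma(t)))\to0$ as $t\to1^-$. It is restricted if $\tilde p_x(\sigma(t))\to1$ non-tangentially, that is, if there is $M>1$ with $|1-\tilde p_x(\sigma(t))|<M\,(1-|\tilde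 p_x(\sigma(t))|)$ for all $t$ close enough to $1$. It is peculiar if for every $R>0$ one has $\limsup_{w\to x}\,[k_{\Delta^n}(\sigma(t),w)-k_{\Delta^n}(0,w)]<\frac12\log R$ for all $t$ close enough to $1$. A function $g\colon\Delta^n\to\mathbb C$ has restricted $K$-limit $L$ at $x$ if $g(\sigma(t))\to L$ as $t\to1^-$ for every special restricted $x$-curve $\sigma$, and has restricted $E$-limit $L$ at $x$ if $g(\sigma(t))\to L$ as $t\to1^-$ for every peculiar $x$-curve $\sigma$. For $v\in\mathbb C^n$ write $\frac{\partial f}{\partial v}(z)=df_z(v)=\sum_j v_j\frac{\partial f}{\partial z_j}(z)$. Theorem 4.1. Let $f\colon\Delta^n\to\Delta$ be holomorphic and let $x\in\partial\Delta^n$ be such that $$\liminf_{w\to x}\frac{1-|f(w)|}{1-\|w\|_\infty}=\alpha<+\infty.$$ Then $f$ has a unique restricted $E$-limit $\tau$ at $x$, it satisfies $|\tau|=1$, and: (i) $\dfrac{\tau-f(z)}{1-\tilde p_x(z)}$ has restricted $K$-limit $\alpha\tau$ at $x$; (ii) if $|x_j|=1$, then $\dfrac{\tau-f(z)}{x_j-z_j}$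 has restricted $K$-limit $\alpha\tau\overline{x_j}$ at $x$; (iii) $\dfrac{\partial f}{\partial x}$ and $\dfrac{\partial f}{\partial\check x}$ both have restricted $K$-limit $\alpha\tau$ at $x$; (iv) if $|x_j|<1$, then $\dfrac{\partial f}{\partial z_j}$ has restricted $K$-limit $0$ at $x$; (v) if $|x_j|=1$, then $\dfrac{\partial f}{\partial z_j}$ has a restricted $K$-limit in $\mathbb C$ at $x$. -/

import Mathlib

open Set Filter Topology Metric

/-- The open unit disk in the complex plane. -/
def unitDisk : Set ℂ := ball 0 1

/-- The unit polydisk. The norm of `Fin n → ℂ` is the sup norm. -/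
def polydisk (n : ℕ) : Set (Fin n → ℂ) := ball 0 1

/-- The value at `z` of the disk automorphism that sends `a` to `0`. -/
noncomputable def diskMap (a z : ℂ) : ℂ := (z - a) / (1 - (starRingEnd ℂ) a * z)

/-- The Poincaré distance of the unit disk. -/
noncomputable def poincareDist (a b : ℂ) : ℝ :=
  1 / 2 * Real.log ((1 + ‖diskMap a b‖) / (1 - ‖diskMap a b‖))

/-- `DiskChain D z w r`: the points `z` and `w` of `D` are joined by a finite chain of holomorphic
disks in `D` of total Poincaré length `r`. -/
inductive DiskChain {E : Type*} [NormedAddCommGroup E] [NormedSpace ℂ E] (D : Set E) :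
    E → E → ℝ → Prop
  | nil (z : E) (hz : z ∈ D) : DiskChain D z z 0
  | cons (φ : ℂ → E) (hφ : DifferentiableOn ℂ φ unitDisk) (hD : MapsTo φ unitDisk D)
      (a b : ℂ) (ha : a ∈ unitDisk) (hb : b ∈ unitDisk) (w : E) (r : ℝ)
      (hr : DiskChain D (φ b) w r) : DiskChain D (φ a) w (poincareDist a b + r)

/-- The Kobayashi (pseudo)distance of `D`: the infimum of the lengths of chains of disks. -/
noncomputable def kobayashiDist {E : Type*} [NormedAddCommGroup E] [NormedSpace ℂ E] (D : Set E)
    (z w : E) : ℝ :=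
  sInf {r : ℝ | DiskChain D z w r}

theorem mem_unitDisk {a : ℂ} : a ∈ unitDisk ↔ ‖a‖ < 1 := by simp [unitDisk]

theorem diskMap_den_ne {a z : ℂ} (ha : ‖a‖ < 1) (hz : ‖z‖ < 1) :
    1 - (starRingEnd ℂ) a * z ≠ 0 := by
  intro h
  have h1 : (starRingEnd ℂ) a * z = 1 := (sub_eq_zero.mp h).symm
  have h2 : ‖a‖ * ‖z‖ = 1 := by
    have := congrArg norm h1
    simpa using this
  nlinarith [norm_nonneg a, norm_nonneg z]

theorem normSq_den_sub (a z : ℂ) :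
    ‖1 - (starRingEnd ℂ) a * z‖ ^ 2 - ‖z - a‖ ^ 2 = (1 - ‖a‖ ^ 2) * (1 - ‖z‖ ^ 2) := by
  simp only [Complex.sq_norm, Complex.normSq_apply]
  simp
  ring

theorem one_sub_diskMap_sq {a z : ℂ} (ha : ‖a‖ < 1) (hz : ‖z‖ < 1) :
    1 - ‖diskMap a z‖ ^ 2 =
      (1 - ‖a‖ ^ 2) * (1 - ‖z‖ ^ 2) / ‖1 - (starRingEnd ℂ) a * z‖ ^ 2 := by
  have h := norm_ne_zero_iff.mpr (diskMap_den_ne ha hz)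
  rw [diskMap, norm_div, div_pow, ← normSq_den_sub a z, eq_div_iff (pow_ne_zero 2 h), sub_mul,
    div_mul_cancel₀ _ (pow_ne_zero 2 h), one_mul]

theorem norm_diskMap_lt {a z : ℂ} (ha : ‖a‖ < 1) (hz : ‖z‖ < 1) : ‖diskMap a z‖ < 1 := by
  have h := norm_pos_iff.mpr (diskMap_den_ne ha hz)
  have h1 := one_sub_diskMap_sq ha hz
  have h2 : 0 < 1 - ‖a‖ ^ 2 := by nlinarith [norm_nonneg a]
  have h3 : 0 < 1 - ‖z‖ ^ 2 := by nlinarith [norm_nonneg z]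
  have h4 : 0 < 1 - ‖diskMap a z‖ ^ 2 := by rw [h1]; positivity
  nlinarith [norm_nonneg (diskMap a z)]

theorem norm_diskMap_comm (a b : ℂ) : ‖diskMap a b‖ = ‖diskMap b a‖ := by
  rw [diskMap, diskMap, norm_div, norm_div, norm_sub_rev b a,
    ← Complex.norm_conj (1 - (starRingEnd ℂ) a * b)]
  simp [mul_comm]

theorem diskMap_neg_diskMap {a z : ℂ} (ha : ‖a‖ < 1) (hz : ‖z‖ < 1) :
    diskMap (-a) (diskMap a z) = z := by
  have h := diskMap_den_ne ha hz
  have h1 := diskMap_den_ne ha ha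
  have h2 : 1 - (starRingEnd ℂ) (-a) * diskMap a z ≠ 0 :=
    diskMap_den_ne (by simpa using ha) (norm_diskMap_lt ha hz)
  rw [diskMap, div_eq_iff h2]
  simp only [diskMap, map_neg]
  rw [mul_comm] at h
  field_simp
  ring

theorem norm_diskMap_diskMap {c a b : ℂ} (hc : ‖c‖ < 1) (ha : ‖a‖ < 1) (hb : ‖b‖ < 1) :
    ‖diskMap (diskMap c a) (diskMap c b)‖ = ‖diskMap a b‖ := by
  have h1 := diskMap_den_ne hc ha
  have h2 := diskMap_den_ne hc hb
  have h3 := diskMap_den_ne ha hb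
  have h4 := diskMap_den_ne hc hc
  have h5 := diskMap_den_ne ha hc
  have h6 := diskMap_den_ne (norm_diskMap_lt hc ha) (norm_diskMap_lt hc hb)
  have e : diskMap (diskMap c a) (diskMap c b) =
      diskMap a b * ((1 - (starRingEnd ℂ) a * c) / (1 - (starRingEnd ℂ) c * a)) := by
    rw [diskMap, div_eq_iff h6]
    simp only [diskMap, map_div₀, map_sub, map_mul, map_one, Complex.conj_conj]
    generalize (starRingEnd ℂ) a = a' at *
    generalize (starRingEnd ℂ) c = c' at *
    have k1 : 1 - a * c' ≠ 0 := by rwa [mul_comm]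
    rw [mul_comm] at h2 h3 h5
    field_simp
    ring
  rw [e, norm_mul, norm_div, ← Complex.norm_conj (1 - (starRingEnd ℂ) a * c)]
  have h7 : (starRingEnd ℂ) (1 - (starRingEnd ℂ) a * c) = 1 - (starRingEnd ℂ) c * a := by
    simp [mul_comm]
  rw [h7, div_self (norm_ne_zero_iff.mpr h1), mul_one]

theorem poincareDist_mono {a b a' b' : ℂ} (h : ‖diskMap a b‖ ≤ ‖diskMap a' b'‖)
    (h' : ‖diskMap a' b'‖ < 1) : poincareDist a b ≤ poincareDist a' b' := by
  unfold poincareDist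
  have h0 := norm_nonneg (diskMap a b)
  have : 0 < 1 - ‖diskMap a' b'‖ := by linarith
  have : 0 < 1 - ‖diskMap a b‖ := by linarith
  gcongr

theorem poincareDist_nonneg {a b : ℂ} (ha : ‖a‖ < 1) (hb : ‖b‖ < 1) : 0 ≤ poincareDist a b := by
  have h := norm_diskMap_lt ha hb
  have h0 := norm_nonneg (diskMap a b)
  refine mul_nonneg (by norm_num) (Real.log_nonneg ?_)
  rw [le_div_iff₀ (by linarith)]
  linarith

theorem poincareDist_triangle {a b c : ℂ} (ha : ‖a‖ < 1) (hb : ‖b‖ < 1) (hc : ‖c‖ < 1) :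
    poincareDist a b ≤ poincareDist a c + poincareDist c b := by
  have hr := norm_diskMap_lt hc ha
  have hs := norm_diskMap_lt hc hb
  have hd := norm_diskMap_lt ha hb
  have key := one_sub_diskMap_sq hr hs
  have hden := norm_pos_iff.mpr (diskMap_den_ne hr hs)
  have hden2 : ‖1 - (starRingEnd ℂ) (diskMap c a) * diskMap c b‖ ≤
      1 + ‖diskMap c a‖ * ‖diskMap c b‖ := by
    refine (norm_sub_le _ _).trans ?_
    simp
  rw [norm_diskMap_diskMap hc ha hb] at key
  unfold poincareDist
  rw [norm_diskMap_comm a c]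
  generalize ‖1 - (starRingEnd ℂ) (diskMap c a) * diskMap c b‖ = q at *
  have hr0 := norm_nonneg (diskMap c a)
  have hs0 := norm_nonneg (diskMap c b)
  have hd0 := norm_nonneg (diskMap a b)
  generalize ‖diskMap c a‖ = r at *
  generalize ‖diskMap c b‖ = s at *
  generalize ‖diskMap a b‖ = d at *
  have hr1 : 0 < 1 - r := by linarith
  have hs1 : 0 < 1 - s := by linarith
  have hd1 : 0 < 1 - d := by linarith
  have hq : q ^ 2 ≤ (1 + r * s) ^ 2 := by gcongr
  have h1 : (1 - d ^ 2) * q ^ 2 = (1 - r ^ 2) * (1 - s ^ 2) := by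
    rw [key]; field_simp
  have h2 : d * (1 + r * s) ≤ r + s := by
    refine le_of_sq_le_sq ?_ (by positivity)
    have : 0 ≤ 1 - d ^ 2 := by nlinarith
    nlinarith [mul_le_mul_of_nonneg_left hq this]
  rw [← mul_add, ← Real.log_mul (by positivity) (by positivity)]
  have h3 : (1 + d) / (1 - d) ≤ (1 + r) / (1 - r) * ((1 + s) / (1 - s)) := by
    rw [div_mul_div_comm, div_le_div_iff₀ hd1 (by positivity)]
    nlinarith
  have := Real.log_le_log (by positivity) h3
  linarith

theorem differentiableOn_diskMap {a : ℂ} (ha : ‖a‖ < 1) :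
    DifferentiableOn ℂ (diskMap a) unitDisk := by
  unfold diskMap
  refine DifferentiableOn.div (by fun_prop) (by fun_prop) fun z hz => ?_
  exact diskMap_den_ne ha (mem_unitDisk.mp hz)

/-- The Schwarz–Pick lemma. -/
theorem poincareDist_le_of_mapsTo {g : ℂ → ℂ} (hg : DifferentiableOn ℂ g unitDisk)
    (hm : MapsTo g unitDisk unitDisk) {a b : ℂ} (ha : a ∈ unitDisk) (hb : b ∈ unitDisk) :
    poincareDist (g a) (g b) ≤ poincareDist a b := by
  have ha' := mem_unitDisk.mp ha
  have hb' := mem_unitDisk.mp hb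
  have hna : ‖-a‖ < 1 := by simpa using ha'
  have hga := mem_unitDisk.mp (hm ha)
  have m1 : MapsTo (diskMap (-a)) unitDisk unitDisk := fun z hz =>
    mem_unitDisk.mpr (norm_diskMap_lt hna (mem_unitDisk.mp hz))
  have m2 : MapsTo (diskMap (g a)) unitDisk unitDisk := fun z hz =>
    mem_unitDisk.mpr (norm_diskMap_lt hga (mem_unitDisk.mp hz))
  have hd : DifferentiableOn ℂ (diskMap (g a) ∘ (g ∘ diskMap (-a))) unitDisk :=
    (differentiableOn_diskMap hga).comp (hg.comp (differentiableOn_diskMap hna) m1) (hm.comp m1)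
  have hmm : MapsTo (diskMap (g a) ∘ (g ∘ diskMap (-a))) unitDisk unitDisk :=
    m2.comp (hm.comp m1)
  have h0 : (diskMap (g a) ∘ (g ∘ diskMap (-a))) 0 = 0 := by simp [diskMap]
  have h := Complex.norm_le_norm_of_mapsTo_ball hd (hmm.mono_right ball_subset_closedBall) h0
    (norm_diskMap_lt ha' hb')
  simp only [Function.comp_apply, diskMap_neg_diskMap ha' hb'] at h
  exact poincareDist_mono h (norm_diskMap_lt ha' hb')

theorem mem_polydisk {n : ℕ} {z : Fin n → ℂ} : z ∈ polydisk n ↔ ∀ j, ‖z j‖ < 1 := by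
  simp [polydisk, pi_norm_lt_iff]

theorem DiskChain.poincareDist_le {n : ℕ} {z w : Fin n → ℂ} {r : ℝ}
    (h : DiskChain (polydisk n) z w r) :
    z ∈ polydisk n ∧ w ∈ polydisk n ∧ 0 ≤ r ∧ ∀ j, poincareDist (z j) (w j) ≤ r := by
  induction h with
  | nil z hz => exact ⟨hz, hz, le_rfl, fun j => by simp [poincareDist, diskMap]⟩
  | cons φ hφ hD a b ha hb w r _ ih =>
    obtain ⟨h1, h2, h3, h4⟩ := ih
    refine ⟨hD ha, h2, add_nonneg
      (poincareDist_nonneg (mem_unitDisk.mp ha) (mem_unitDisk.mp hb)) h3, fun j => ?_⟩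
    refine (poincareDist_triangle (mem_polydisk.mp (hD ha) j) (mem_polydisk.mp h2 j)
      (mem_polydisk.mp h1 j)).trans (add_le_add ?_ (h4 j))
    exact poincareDist_le_of_mapsTo (g := fun ζ => φ ζ j) (differentiableOn_pi.mp hφ j)
      (fun ζ hζ => mem_unitDisk.mpr (mem_polydisk.mp (hD hζ) j)) ha hb

/-- The Kobayashi distance of the polydisk is the largest of the Poincaré distances of the
coordinates. -/
theorem kobayashiDist_polydisk {n : ℕ} {z w : Fin n → ℂ} (hz : z ∈ polydisk n)
    (hw : w ∈ polydisk n) :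
    kobayashiDist (polydisk n) z w = ⨆ j, poincareDist (z j) (w j) := by
  have hz' := mem_polydisk.mp hz
  have hw' := mem_polydisk.mp hw
  suffices h : IsLeast {r : ℝ | DiskChain (polydisk n) z w r} (⨆ j, poincareDist (z j) (w j)) from
    h.csInf_eq
  refine ⟨?_, fun r hr => ?_⟩
  swap
  · obtain ⟨-, -, h3, h4⟩ := hr.poincareDist_le
    exact Real.iSup_le h4 h3
  show DiskChain (polydisk n) z w _
  rcases isEmpty_or_nonempty (Fin n) with hn | hn
  · rw [Subsingleton.elim w z, Real.iSup_of_isEmpty]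
    exact DiskChain.nil z hz
  obtain ⟨k, hk⟩ := exists_eq_ciSup_of_finite (f := fun j => ‖diskMap (z j) (w j)‖)
  have hle : ∀ j, ‖diskMap (z j) (w j)‖ ≤ ‖diskMap (z k) (w k)‖ := fun j => by
    rw [hk]; exact le_ciSup (f := fun j => ‖diskMap (z j) (w j)‖) (Set.finite_range _).bddAbove j
  have hkl := norm_diskMap_lt (hz' k) (hw' k)
  have hsup : (⨆ j, poincareDist (z j) (w j)) = poincareDist (z k) (w k) :=
    le_antisymm (ciSup_le fun j => poincareDist_mono (hle j) hkl)
      (le_ciSup (f := fun j => poincareDist (z j) (w j)) (Set.finite_range _).bddAbove k)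
  rw [hsup]
  set d : ℝ := ‖diskMap (z k) (w k)‖ with hd
  let φ : ℂ → Fin n → ℂ := fun ζ j => diskMap (-z j) (ζ * (diskMap (z j) (w j) / d))
  have hc : ∀ j, ‖diskMap (z j) (w j) / (d : ℂ)‖ ≤ 1 := fun j => by
    rw [norm_div, Complex.norm_real, Real.norm_eq_abs, abs_of_nonneg (norm_nonneg _)]
    exact div_le_one_of_le₀ (hle j) (norm_nonneg _)
  have hb : ∀ j, ∀ ζ ∈ unitDisk, ζ * (diskMap (z j) (w j) / (d : ℂ)) ∈ unitDisk := by
    intro j ζ hζ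
    rw [mem_unitDisk] at hζ ⊢
    rw [norm_mul]
    nlinarith [hc j, norm_nonneg ζ, norm_nonneg (diskMap (z j) (w j) / (d : ℂ))]
  have hnz : ∀ j, ‖-z j‖ < 1 := fun j => by simpa using hz' j
  have hφ : DifferentiableOn ℂ φ unitDisk := differentiableOn_pi.mpr fun j =>
    (differentiableOn_diskMap (hnz j)).comp (by fun_prop) (hb j)
  have hD : MapsTo φ unitDisk (polydisk n) := fun ζ hζ => mem_polydisk.mpr fun j =>
    norm_diskMap_lt (hnz j) (mem_unitDisk.mp (hb j ζ hζ))
  have h0 : φ 0 = z := by ext j; simp [φ, diskMap]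
  have h1 : φ d = w := by
    ext j
    have : (d : ℂ) * (diskMap (z j) (w j) / (d : ℂ)) = diskMap (z j) (w j) := by
      rcases eq_or_ne d 0 with h | h
      · have : diskMap (z j) (w j) = 0 := norm_le_zero_iff.mp ((hle j).trans h.le)
        simp [this]
      · have : (d : ℂ) ≠ 0 := by exact_mod_cast h
        field_simp
    simp only [φ, this]
    exact diskMap_neg_diskMap (hz' j) (hw' j)
  have hdd : (d : ℂ) ∈ unitDisk := by
    rw [mem_unitDisk, Complex.norm_real, Real.norm_eq_abs, abs_of_nonneg (norm_nonneg _)]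
    exact hkl
  have hlen : poincareDist (z k) (w k) = poincareDist 0 d + 0 := by
    simp only [poincareDist, add_zero]
    have : diskMap 0 (d : ℂ) = d := by simp [diskMap]
    rw [this, Complex.norm_real, Real.norm_eq_abs, abs_of_nonneg (norm_nonneg _)]
  rw [hlen]
  have := DiskChain.cons φ hφ hD 0 d (by simp [unitDisk]) hdd w 0
    (by rw [h1]; exact DiskChain.nil w hw)
  rwa [h0] at this

/-- The Šilov degree of `x`: the number of components of absolute value one. -/
noncomputable def silovDegree {n : ℕ} (x : Fin n → ℂ) : ℕ :=
  (Finset.univ.filter fun j => ‖x j‖ = 1).card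

/-- The Šilov part of `x`: the components of absolute value less than one are replaced by `0`. -/
noncomputable def silovPart {n : ℕ} (x : Fin n → ℂ) : Fin n → ℂ :=
  fun j => if ‖x j‖ = 1 then x j else 0

/-- The complex geodesic associated to `x`. -/
def geodesic {n : ℕ} (x : Fin n → ℂ) (ζ : ℂ) : Fin n → ℂ := ζ • x

/-- The left-inverse function associated to `x`: the hermitian product of `z` with the Šilov part
of `x`, divided by the Šilov degree of `x`. -/
noncomputable def leftInv {n : ℕ} (x z : Fin n → ℂ) : ℂ :=
  1 / (silovDegree x : ℂ) * ∑ j, z j * (starRingEnd ℂ) (silovPart x j)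

/-- The holomorphic retraction associated to `x`, which is the canonical projection device. -/
noncomputable def retraction {n : ℕ} (x z : Fin n → ℂ) : Fin n → ℂ := geodesic x (leftInv x z)

/-- Continuous curves in the polydisk, parametrized by `[0, 1)`, that tend to `x`. -/
def IsCurveTo {n : ℕ} (x : Fin n → ℂ) (σ : ℝ → Fin n → ℂ) : Prop :=
  ContinuousOn σ (Ico 0 1) ∧ MapsTo σ (Ico 0 1) (polydisk n) ∧ Tendsto σ (𝓝[<] 1) (𝓝 x)

/-- The Kobayashi distance between the curve and its projection tends to `0`. -/
def IsSpecial {n : ℕ} (x : Fin n → ℂ) (σ : ℝ → Fin n → ℂ) : Prop :=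
  Tendsto (fun t => kobayashiDist (polydisk n) (σ t) (retraction x (σ t))) (𝓝[<] 1) (𝓝 0)

/-- The Stolz region of vertex `τ` and amplitude `M`. -/
def stolzRegion (τ : ℂ) (M : ℝ) : Set ℂ := {ζ | ζ ∈ unitDisk ∧ ‖τ - ζ‖ / (1 - ‖ζ‖) < M}

/-- The projected curve `leftInv x ∘ σ` tends to `1` non-tangentially. -/
def IsRestricted {n : ℕ} (x : Fin n → ℂ) (σ : ℝ → Fin n → ℂ) : Prop :=
  ∃ M : ℝ, 1 < M ∧ ∀ᶠ t in 𝓝[<] 1, leftInv x (σ t) ∈ stolzRegion 1 M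

/-- `g` has restricted `K`-limit `L` at `x`, with respect to the canonical projection device. -/
def HasRestrictedKLimit {n : ℕ} (g : (Fin n → ℂ) → ℂ) (x : Fin n → ℂ) (L : ℂ) : Prop :=
  ∀ σ : ℝ → Fin n → ℂ, IsCurveTo x σ → IsSpecial x σ → IsRestricted x σ →
    Tendsto (fun t => g (σ t)) (𝓝[<] 1) (𝓝 L)

/-- The (small) horosphere of center `x` and radius `R`. -/
def horosphere {n : ℕ} (x : Fin n → ℂ) (R : ℝ) : Set (Fin n → ℂ) :=
  {z | z ∈ polydisk n ∧
    limsup (fun w => ((kobayashiDist (polydisk n) z w - kobayashiDist (polydisk n) 0 w : ℝ) :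
      EReal)) (𝓝[polydisk n] x) < ((1 / 2 * Real.log R : ℝ) : EReal)}

/-- The curve is eventually contained in every horosphere of center `x`. -/
def IsPeculiar {n : ℕ} (x : Fin n → ℂ) (σ : ℝ → Fin n → ℂ) : Prop :=
  ∀ R : ℝ, 0 < R → ∀ᶠ t in 𝓝[<] 1, σ t ∈ horosphere x R

/-- `g` has restricted `E`-limit `L` at `x`. -/
def HasRestrictedELimit {n : ℕ} (g : (Fin n → ℂ) → ℂ) (x : Fin n → ℂ) (L : ℂ) : Prop :=
  ∀ σ : ℝ → Fin n → ℂ, IsCurveTo x σ → IsPeculiar x σ →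
    Tendsto (fun t => g (σ t)) (𝓝[<] 1) (𝓝 L)

/-- The derivative of `f` in the direction `v`: `∂f/∂v (z) = df_z(v)`. -/
noncomputable def dirDeriv {n : ℕ} (f : (Fin n → ℂ) → ℂ) (v z : Fin n → ℂ) : ℂ := fderiv ℂ f z v

/-!
The proof reduces every assertion to the disk, through Julia's lemma and Schwarz–Pick comparisons.

*Julia's lemma* (`exists_julia`). Along an ultrafilter that realizes the lower limit `α`, the values
of `f` converge to some `τ` with `|τ| = 1`, and contraction of the Kobayashi distance shows that `f`
maps the horosphere of center `x` and radius `R` into the closed horodisk of center `τ` and radius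
`α R`. Peculiar curves enter all horospheres, which gives the restricted `E`-limit; it is unique
because the radial curve is peculiar.

*The disk* (`exists_angular_derivative`). For a self-map `φ` of the disk that satisfies Julia's
inequality at `1`, put `H = (τ + φ) / (τ - φ)` and `Q(η) = (1 + η) / (1 - η)`, and let `B` be the
largest constant with `Re (H - B Q) ≥ 0`. By the extremality of `B` and the Schwarz–Pick lemma for
the half-plane, `(1 - η) (H - B Q)` tends to `0` in Stolz regions, so `(τ - φ) / (1 - η)` tends to
`τ / B`. This applies to `f` along the geodesic `η ↦ η x`, with `1 / B = α` (`tendsto_geodesic`),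
and along the disks `η ↦ η x + δ (1 - η) (β_j x_j)_j` with `0 ≤ β_j ≤ 1` and `0 ≤ δ < 1`
(`boundaryDisk`), since these enter the horospheres of `x` at least as fast as the geodesic does.

*Special curves.* If two families of points are asymptotic for the Kobayashi distance, then
quotients `(τ - f) / D` have the same limit along both (`tendsto_of_tendsto_diskMap`). Comparing a
special restricted curve `σ` with its projection yields the limits of the difference quotients.

*Derivatives* (`exists_tendsto_dirDeriv`). Let `v_j = β_j x_j` whenever `|x_j| = 1`, and let `ζ` be
the projection of `σ` to the disk. The functions
`h_t(z) = (τ - f(σ(t) + (1 - ζ(t)) z v)) / (1 - ζ(t))` are holomorphic and uniformly bounded on a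
fixed disk, because there the argument stays within a bounded Kobayashi distance of `ζ(t) x`. For
real `δ ≥ 0` the argument is asymptotic to the disk above, so `h_t(δ)` tends to its angular
derivative `c(δ)`. By the Schwarz lemma the derivatives `h_t'(0)`, which are minus the
derivatives of `f` in the direction `v` at `σ(t)`, converge to the one-sided derivative of `c` at
`0` (`exists_tendsto_deriv`). This limit does not depend on `σ`. The function `c` is
`(1 - δ) α τ` when all `β_j` are `1` and constant when all are `0`; this gives the explicit limits.
-/

/-! ### Schwarz–Pick estimates in the disk and the polydisk -/

theorem norm_diskMap_le_of_poincareDist_le {a b : ℂ} {ρ : ℝ} (h : ‖diskMap a b‖ < 1)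
    (hρ0 : 0 ≤ ρ) (hρ : ρ < 1)
    (hle : poincareDist a b ≤ 1 / 2 * Real.log ((1 + ρ) / (1 - ρ))) : ‖diskMap a b‖ ≤ ρ := by
  unfold poincareDist at hle
  have h0 := norm_nonneg (diskMap a b)
  generalize ‖diskMap a b‖ = d at *
  have hd : 0 < 1 - d := by linarith
  have hr : 0 < 1 - ρ := by linarith
  have h1 := (Real.log_le_log_iff (by positivity) (by positivity)).mp
    (show Real.log ((1 + d) / (1 - d)) ≤ Real.log ((1 + ρ) / (1 - ρ)) by linarith)
  rw [div_le_div_iff₀ hd hr] at h1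
  nlinarith

theorem half_norm_diskMap_le_poincareDist {a b : ℂ} (h : ‖diskMap a b‖ < 1) :
    ‖diskMap a b‖ / 2 ≤ poincareDist a b := by
  unfold poincareDist
  have h0 := norm_nonneg (diskMap a b)
  generalize ‖diskMap a b‖ = d at *
  have hd : 0 < 1 - d := by linarith
  have h1 := Real.one_sub_inv_le_log_of_pos (show 0 < (1 + d) / (1 - d) by positivity)
  have h2 : d ≤ 1 - ((1 + d) / (1 - d))⁻¹ := by
    rw [inv_div, le_sub_iff_add_le, ← le_sub_iff_add_le', div_le_iff₀ (by positivity)]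
    nlinarith
  linarith

/-- The Schwarz–Pick lemma for the pseudohyperbolic distance. -/
theorem norm_diskMap_map_le {g : ℂ → ℂ} (hg : DifferentiableOn ℂ g unitDisk)
    (hm : MapsTo g unitDisk unitDisk) {a b : ℂ} (ha : a ∈ unitDisk) (hb : b ∈ unitDisk) :
    ‖diskMap (g a) (g b)‖ ≤ ‖diskMap a b‖ :=
  norm_diskMap_le_of_poincareDist_le
    (norm_diskMap_lt (mem_unitDisk.mp (hm ha)) (mem_unitDisk.mp (hm hb))) (norm_nonneg _)
    (norm_diskMap_lt (mem_unitDisk.mp ha) (mem_unitDisk.mp hb))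
    (poincareDist_le_of_mapsTo hg hm ha hb)

/-- A pseudohyperbolic disk of center `a` is small compared with the distance of `a` to the
unit circle. -/
theorem norm_sub_le_of_norm_diskMap_le {a b : ℂ} {ρ : ℝ} (ha : ‖a‖ < 1) (hb : ‖b‖ < 1)
    (hρ : ρ < 1) (h : ‖diskMap a b‖ ≤ ρ) : ‖b - a‖ ≤ 2 * ρ / (1 - ρ) * (1 - ‖a‖) := by
  have hden := norm_pos_iff.mpr (diskMap_den_ne ha hb)
  have hρ0 : 0 ≤ ρ := (norm_nonneg _).trans h
  rw [diskMap, norm_div, div_le_iff₀ hden] at h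
  have h1 : ‖1 - (starRingEnd ℂ) a * b‖ ≤ (1 - ‖a‖ ^ 2) + ‖a‖ * ‖b - a‖ := by
    have e : 1 - (starRingEnd ℂ) a * b = ((1 - ‖a‖ ^ 2 : ℝ) : ℂ) - (starRingEnd ℂ) a * (b - a) := by
      have := Complex.conj_mul' a
      push_cast
      rw [← this]; ring
    rw [e]
    refine (norm_sub_le _ _).trans ?_
    rw [norm_mul, RCLike.norm_conj, Complex.norm_real, Real.norm_of_nonneg]
    nlinarith [norm_nonneg a]
  rw [div_mul_eq_mul_div, le_div_iff₀ (by linarith)]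
  have h2 : ‖1 - (starRingEnd ℂ) a * b‖ ≤ 2 * (1 - ‖a‖) + ‖b - a‖ := by
    nlinarith [norm_nonneg a, norm_nonneg (b - a)]
  nlinarith [mul_le_mul_of_nonneg_left h2 hρ0]

theorem norm_diskMap_le_of_norm_sub_le {a b : ℂ} {s : ℝ} (ha : ‖a‖ < 1) (hs : s < 1)
    (h : ‖b - a‖ ≤ s * (1 - ‖a‖)) : ‖b‖ < 1 ∧ ‖diskMap a b‖ ≤ s := by
  have hb : ‖b‖ < 1 := by
    have : ‖b‖ ≤ ‖a‖ + ‖b - a‖ := norm_le_norm_add_norm_sub' b a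
    nlinarith
  refine ⟨hb, ?_⟩
  have hden := norm_pos_iff.mpr (diskMap_den_ne ha hb)
  rw [diskMap, norm_div, div_le_iff₀ hden]
  have h1 : 1 - ‖a‖ ≤ ‖1 - (starRingEnd ℂ) a * b‖ := by
    have h2 := norm_sub_norm_le 1 ((starRingEnd ℂ) a * b)
    rw [norm_mul, RCLike.norm_conj, norm_one] at h2
    nlinarith [norm_nonneg a]
  have hs0 : 0 ≤ s := nonneg_of_mul_nonneg_left ((norm_nonneg _).trans h) (by linarith)
  exact h.trans (mul_le_mul_of_nonneg_left h1 hs0)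

/-- With `ρ` the pseudohyperbolic distance, the left side is `(1 + ρ)² / (1 - ρ²)`; the numerator is
at most `4` and the denominator is explicit. -/
theorem one_add_div_one_sub_norm_diskMap_le {a b : ℂ} (ha : ‖a‖ < 1) (hb : ‖b‖ < 1) :
    (1 + ‖diskMap a b‖) / (1 - ‖diskMap a b‖) ≤
      4 * ‖1 - (starRingEnd ℂ) a * b‖ ^ 2 / ((1 - ‖a‖ ^ 2) * (1 - ‖b‖ ^ 2)) := by
  have h := norm_diskMap_lt ha hb
  have h0 := norm_nonneg (diskMap a b)
  have key := one_sub_diskMap_sq ha hb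
  have hden := norm_pos_iff.mpr (diskMap_den_ne ha hb)
  have h2 : 0 < 1 - ‖a‖ ^ 2 := by nlinarith [norm_nonneg a]
  have h3 : 0 < 1 - ‖b‖ ^ 2 := by nlinarith [norm_nonneg b]
  generalize ‖diskMap a b‖ = d at *
  generalize ‖1 - (starRingEnd ℂ) a * b‖ = q at *
  have hd : 0 < 1 - d := by linarith
  have h4 : 4 * q ^ 2 / ((1 - ‖a‖ ^ 2) * (1 - ‖b‖ ^ 2)) = 4 / (1 - d ^ 2) := by
    rw [key]; field_simp
  rw [h4, div_le_div_iff₀ hd (by nlinarith)]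
  nlinarith [mul_nonneg hd.le (mul_nonneg hd.le (by linarith : 0 ≤ 3 + d))]

/-- Schwarz–Pick lemma for maps of the disk to the right half-plane: with `ρ` the pseudohyperbolic
distance of `a` and `b`, the value at `b` lies in a Euclidean disk centered at `i Im K(a)` whose
radius is proportional to `Re K(a)`. -/
theorem norm_sub_im_le_of_re_pos {K : ℂ → ℂ} (hK : DifferentiableOn ℂ K unitDisk)
    (hpos : ∀ z ∈ unitDisk, 0 < (K z).re) {a b : ℂ} (ha : a ∈ unitDisk) (hb : b ∈ unitDisk) :
    ‖K b - (K a).im * Complex.I‖ ≤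
      (K a).re * ((1 + ‖diskMap a b‖) / (1 - ‖diskMap a b‖)) := by
  have hne : ∀ z ∈ unitDisk, K z + (starRingEnd ℂ) (K a) ≠ 0 := fun z hz h => by
    have := congrArg Complex.re h
    simp at this
    linarith [hpos z hz, hpos a ha]
  set T : ℂ → ℂ := fun z => (K z - K a) / (K z + (starRingEnd ℂ) (K a)) with hT
  have hTd : DifferentiableOn ℂ T unitDisk := (hK.sub_const _).div (hK.add_const _) hne
  have hTm : MapsTo T unitDisk unitDisk := fun z hz => by
    rw [mem_unitDisk, hT, norm_div, div_lt_one (norm_pos_iff.mpr (hne z hz))]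
    refine lt_of_pow_lt_pow_left₀ 2 (norm_nonneg _) ?_
    simp only [Complex.sq_norm, Complex.normSq_apply]
    simp
    nlinarith [hpos z hz, hpos a ha]
  have h := norm_diskMap_map_le hTd hTm ha hb
  have hρ := norm_diskMap_lt (mem_unitDisk.mp ha) (mem_unitDisk.mp hb)
  have hT0 : T a = 0 := by simp [hT]
  rw [hT0, show diskMap 0 (T b) = T b by simp [diskMap], hT, norm_div,
    div_le_iff₀ (norm_pos_iff.mpr (hne b hb))] at h
  have hre := hpos a ha
  set X := K b - (K a).im * Complex.I with hX
  have e1 : K b - K a = X - ((K a).re : ℂ) := by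
    rw [hX]; nth_rewrite 1 [← Complex.re_add_im (K a)]; ring
  have e2 : K b + (starRingEnd ℂ) (K a) = X + ((K a).re : ℂ) := by
    rw [hX]
    apply Complex.ext <;> simp
    ring
  rw [e1, e2] at h
  have h1 : ‖X‖ - (K a).re ≤ ‖X - ((K a).re : ℂ)‖ := by
    have := norm_sub_norm_le X ((K a).re : ℂ)
    rwa [Complex.norm_real, Real.norm_of_nonneg hre.le] at this
  have h2 : ‖X + ((K a).re : ℂ)‖ ≤ ‖X‖ + (K a).re := by
    have := norm_add_le X ((K a).re : ℂ)
    rwa [Complex.norm_real, Real.norm_of_nonneg hre.le] at this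
  rw [← mul_div_assoc, le_div_iff₀ (by linarith)]
  nlinarith [norm_nonneg (diskMap a b), mul_le_mul_of_nonneg_left h2 (norm_nonneg (diskMap a b))]

theorem DiskChain.poincareDist_map_le {n : ℕ} {f : (Fin n → ℂ) → ℂ}
    (hf : DifferentiableOn ℂ f (polydisk n)) (hmaps : MapsTo f (polydisk n) unitDisk)
    {z w : Fin n → ℂ} {r : ℝ} (h : DiskChain (polydisk n) z w r) :
    poincareDist (f z) (f w) ≤ r := by
  induction h with
  | nil z hz => simp [poincareDist, diskMap]
  | cons φ hφ hD a b ha hb w r h ih =>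
    refine (poincareDist_triangle (mem_unitDisk.mp (hmaps (hD ha)))
      (mem_unitDisk.mp (hmaps h.poincareDist_le.2.1)) (mem_unitDisk.mp (hmaps (hD hb)))).trans
      (add_le_add ?_ ih)
    exact poincareDist_le_of_mapsTo (g := f ∘ φ) (hf.comp hφ hD) (hmaps.comp hD) ha hb

theorem eq_of_poincareDist_le_zero {a b : ℂ} (ha : ‖a‖ < 1) (hb : ‖b‖ < 1)
    (h : poincareDist a b ≤ 0) : a = b := by
  have h1 := half_norm_diskMap_le_poincareDist (norm_diskMap_lt ha hb)
  have h2 : diskMap a b = 0 := norm_le_zero_iff.mp (by linarith)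
  rw [diskMap, div_eq_zero_iff, or_iff_left (diskMap_den_ne ha hb)] at h2
  exact (sub_eq_zero.mp h2).symm

theorem poincareDist_le_kobayashiDist {n : ℕ} {z w : Fin n → ℂ} (hz : z ∈ polydisk n)
    (hw : w ∈ polydisk n) (j : Fin n) :
    poincareDist (z j) (w j) ≤ kobayashiDist (polydisk n) z w := by
  rw [kobayashiDist_polydisk hz hw]
  exact le_ciSup (f := fun j => poincareDist (z j) (w j)) (Set.finite_range _).bddAbove j

/-- Holomorphic maps of the polydisk to the disk do not increase the Kobayashi distance. -/
theorem poincareDist_map_le_kobayashiDist {n : ℕ} {f : (Fin n → ℂ) → ℂ}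
    (hf : DifferentiableOn ℂ f (polydisk n)) (hmaps : MapsTo f (polydisk n) unitDisk)
    {z w : Fin n → ℂ} (hz : z ∈ polydisk n) (hw : w ∈ polydisk n) :
    poincareDist (f z) (f w) ≤ kobayashiDist (polydisk n) z w := by
  rcases Set.eq_empty_or_nonempty {r : ℝ | DiskChain (polydisk n) z w r} with h | h
  · -- Without chains the junk value of the infimum is `0`, which forces `z = w`.
    have h0 : kobayashiDist (polydisk n) z w = 0 := by rw [kobayashiDist, h, Real.sInf_empty]
    have hzw : z = w := funext fun j => eq_of_poincareDist_le_zero (mem_polydisk.mp hz j)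
      (mem_polydisk.mp hw j) ((poincareDist_le_kobayashiDist hz hw j).trans h0.le)
    rw [h0, hzw]
    simp [poincareDist, diskMap]
  · exact le_csInf h fun r hr => DiskChain.poincareDist_map_le hf hmaps hr

/-- The Schwarz–Pick lemma on the polydisk; the norm on the right is the maximum of the
pseudohyperbolic distances of the components. -/
theorem norm_diskMap_map_le_pi {n : ℕ} {f : (Fin n → ℂ) → ℂ}
    (hf : DifferentiableOn ℂ f (polydisk n)) (hmaps : MapsTo f (polydisk n) unitDisk)
    {z w : Fin n → ℂ} (hz : z ∈ polydisk n) (hw : w ∈ polydisk n) :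
    ‖diskMap (f z) (f w)‖ ≤ ‖fun j => diskMap (z j) (w j)‖ := by
  have hlt : ‖fun j => diskMap (z j) (w j)‖ < 1 := (pi_norm_lt_iff one_pos).mpr fun j =>
    norm_diskMap_lt (mem_polydisk.mp hz j) (mem_polydisk.mp hw j)
  refine norm_diskMap_le_of_poincareDist_le
    (norm_diskMap_lt (mem_unitDisk.mp (hmaps hz)) (mem_unitDisk.mp (hmaps hw))) (norm_nonneg _)
    hlt ((poincareDist_map_le_kobayashiDist hf hmaps hz hw).trans ?_)
  rw [kobayashiDist_polydisk hz hw]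
  set N := ‖fun j => diskMap (z j) (w j)‖ with hN
  have hN0 : 0 ≤ N := norm_nonneg _
  have h1 : 0 < 1 - N := by linarith
  refine Real.iSup_le (fun j => ?_) (mul_nonneg (by norm_num) (Real.log_nonneg ?_))
  · unfold poincareDist
    have hj : ‖diskMap (z j) (w j)‖ ≤ N := norm_le_pi_norm (fun j => diskMap (z j) (w j)) j
    have h2 : 0 < 1 - ‖diskMap (z j) (w j)‖ := by linarith
    have := norm_nonneg (diskMap (z j) (w j))
    gcongr
  · rw [le_div_iff₀ h1]; linarith

/-! ### The Julia–Wolff–Carathéodory theorem in the disk -/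

theorem one_sub_ne_zero_of_mem_unitDisk {η : ℂ} (h : η ∈ unitDisk) : 1 - η ≠ 0 := fun h1 => by
  have h2 := mem_unitDisk.mp h
  rw [← sub_eq_zero.mp h1, norm_one] at h2
  exact lt_irrefl _ h2

/-- The real part of the Cayley transform. -/
theorem re_add_div_sub {τ a : ℂ} (hτ : ‖τ‖ = 1) (h : τ - a ≠ 0) :
    ((τ + a) / (τ - a)).re = (1 - ‖a‖ ^ 2) / ‖τ - a‖ ^ 2 := by
  have h1 : (τ + a) / (τ - a) = (τ + a) * (starRingEnd ℂ) (τ - a) / ((‖τ - a‖ ^ 2 : ℝ) : ℂ) := by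
    push_cast
    rw [← Complex.mul_conj', mul_div_mul_right _ _ ((map_ne_zero _).mpr h)]
  rw [h1, Complex.div_ofReal_re]
  congr 1
  have h2 : τ.re * τ.re + τ.im * τ.im = 1 := by
    rw [← Complex.normSq_apply, ← Complex.sq_norm, hτ, one_pow]
  rw [Complex.sq_norm, Complex.normSq_apply]
  simp
  linear_combination h2

/-- The Julia–Wolff–Carathéodory theorem in the disk: Julia's inequality at the boundary point `1`
yields a finite angular derivative. -/
theorem exists_angular_derivative {φ : ℂ → ℂ} (hφ : DifferentiableOn ℂ φ unitDisk)
    (hm : MapsTo φ unitDisk unitDisk) {τ : ℂ} (hτ : ‖τ‖ = 1) {A : ℝ}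
    (hA : ∀ η ∈ unitDisk, ‖τ - φ η‖ ^ 2 * (1 - ‖η‖ ^ 2) ≤ A * ‖1 - η‖ ^ 2 * (1 - ‖φ η‖ ^ 2)) :
    ∃ c : ℝ, 0 < c ∧ c ≤ A ∧ ∀ M : ℝ,
      Tendsto (fun η => (τ - φ η) / (1 - η)) (𝓝[stolzRegion 1 M] 1) (𝓝 (c * τ)) := by
  have hsq : ∀ {z : ℂ}, z ∈ unitDisk → 0 < 1 - ‖z‖ ^ 2 := fun {z} hz => by
    nlinarith [norm_nonneg z, mem_unitDisk.mp hz]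
  have hne : ∀ η ∈ unitDisk, τ - φ η ≠ 0 := fun η hη h => by
    have := mem_unitDisk.mp (hm hη)
    rw [← sub_eq_zero.mp h, hτ] at this
    exact lt_irrefl _ this
  have h0 : (0 : ℂ) ∈ unitDisk := by simp [unitDisk]
  have hA0 : 0 < A := by
    have h1 := hA 0 h0
    have h2 := norm_pos_iff.mpr (hne 0 h0)
    have h3 := hsq (hm h0)
    simp only [norm_zero, sub_zero, norm_one] at h1
    by_contra hc
    nlinarith [mul_nonneg (neg_nonneg.mpr (not_lt.mp hc)) h3.le, pow_pos h2 2]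
  set H : ℂ → ℂ := fun η => (τ + φ η) / (τ - φ η) with hH
  set Q : ℂ → ℂ := fun η => (1 + η) / (1 - η) with hQ
  have hQre : ∀ η ∈ unitDisk, (Q η).re = (1 - ‖η‖ ^ 2) / ‖1 - η‖ ^ 2 := fun η hη =>
    re_add_div_sub norm_one (one_sub_ne_zero_of_mem_unitDisk hη)
  have hQpos : ∀ η ∈ unitDisk, 0 < (Q η).re := fun η hη => by
    rw [hQre η hη]
    exact div_pos (hsq hη) (pow_pos (norm_pos_iff.mpr (one_sub_ne_zero_of_mem_unitDisk hη)) 2)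
  have hHQ : ∀ η ∈ unitDisk, 1 / A ≤ (H η).re / (Q η).re := fun η hη => by
    have h1 := norm_pos_iff.mpr (one_sub_ne_zero_of_mem_unitDisk hη)
    have h2 := norm_pos_iff.mpr (hne η hη)
    have h3 := hsq hη
    have h4 : (H η).re = _ := re_add_div_sub hτ (hne η hη)
    rw [hQre η hη, h4, div_div_div_eq, div_le_div_iff₀ hA0 (by positivity)]
    linarith [hA η hη]
  -- `B` is the largest constant for which the real part of `H - B Q` is nonnegative.
  set S : Set ℝ := (fun η => (H η).re / (Q η).re) '' unitDisk with hS
  have hSne : S.Nonempty := ⟨_, 0, h0, rfl⟩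
  have hSb : BddBelow S := ⟨1 / A, by rintro _ ⟨η, hη, rfl⟩; exact hHQ η hη⟩
  set B : ℝ := sInf S with hB
  have hAB : 1 / A ≤ B := le_csInf hSne (by rintro _ ⟨η, hη, rfl⟩; exact hHQ η hη)
  have hB0 : 0 < B := (by positivity : 0 < 1 / A).trans_le hAB
  set G : ℂ → ℂ := fun η => H η - B * Q η with hG
  have hGre : ∀ η, (G η).re = (H η).re - B * (Q η).re := fun η => by simp [hG]
  have hGnn : ∀ η ∈ unitDisk, 0 ≤ (G η).re := fun η hη => by
    have h1 : B ≤ (H η).re / (Q η).re := csInf_le hSb ⟨η, hη, rfl⟩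
    rw [le_div_iff₀ (hQpos η hη)] at h1
    rw [hGre]; linarith
  have hGsmall : ∀ ε > 0, ∃ η ∈ unitDisk, (G η).re < ε * (Q η).re := fun ε hε => by
    obtain ⟨_, ⟨η, hη, rfl⟩, h⟩ := exists_lt_of_csInf_lt hSne (show sInf S < B + ε by linarith)
    refine ⟨η, hη, ?_⟩
    rw [div_lt_iff₀ (hQpos η hη)] at h
    rw [hGre]; linarith
  have hGd : DifferentiableOn ℂ G unitDisk :=
    ((hφ.const_add τ).div (hφ.const_sub τ) hne).sub
      (DifferentiableOn.const_mul (DifferentiableOn.div (by fun_prop) (by fun_prop)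
        fun η hη => one_sub_ne_zero_of_mem_unitDisk hη) _)
  have hGlim : ∀ M : ℝ, Tendsto (fun η => (1 - η) * G η) (𝓝[stolzRegion 1 M] 1) (𝓝 0) := by
    intro M
    have hM : ∀ η ∈ stolzRegion 1 M, 0 < M := fun η hη =>
      (div_nonneg (norm_nonneg _) (by linarith [mem_unitDisk.mp hη.1])).trans_lt hη.2
    by_cases hMpos : 0 < M
    swap
    · have : stolzRegion 1 M = ∅ := Set.eq_empty_of_forall_notMem fun η hη => hMpos (hM η hη)
      simp [this]
    rw [Metric.tendsto_nhds]
    intro ε' hε'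
    obtain ⟨ε, hε, hεε⟩ : ∃ ε, 0 < ε ∧ 8 * M * ε < ε' :=
      ⟨ε' / (16 * M), by positivity, by field_simp; linarith⟩
    obtain ⟨a, ha, haG⟩ := hGsmall ε hε
    set δ := ε * (Q a).re with hδ
    have hδ0 : 0 < δ := mul_pos hε (hQpos a ha)
    -- Adding `δ` makes the real part strictly positive.
    have hK := fun η (hη : η ∈ unitDisk) => norm_sub_im_le_of_re_pos (K := fun η => G η + (δ : ℂ))
      (hGd.add_const _) (fun z hz => by simpa using add_pos_of_nonneg_of_pos (hGnn z hz) hδ0) ha hη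
    set b : ℂ := (δ : ℂ) - (G a + (δ : ℂ)).im * Complex.I with hb
    have hcont : Tendsto (fun η : ℂ => ‖1 - η‖ * ‖b‖ +
        2 * δ * (4 * M * ‖1 - (starRingEnd ℂ) a * η‖ ^ 2 / (1 - ‖a‖ ^ 2)))
        (𝓝[stolzRegion 1 M] 1) (𝓝 (8 * M * ε)) := by
      have h1 : ‖1 - (1 : ℂ)‖ * ‖b‖ +
          2 * δ * (4 * M * ‖1 - (starRingEnd ℂ) a * 1‖ ^ 2 / (1 - ‖a‖ ^ 2)) = 8 * M * ε := by
        have h2 : ‖1 - (starRingEnd ℂ) a * 1‖ = ‖1 - a‖ := by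
          rw [← Complex.norm_conj (1 - a)]; simp
        have h3 := hsq ha
        have h4 := norm_pos_iff.mpr (one_sub_ne_zero_of_mem_unitDisk ha)
        rw [h2, hδ, hQre a ha]
        simp
        field_simp
        ring
      rw [← h1]
      refine tendsto_nhdsWithin_of_tendsto_nhds (Continuous.tendsto ?_ _)
      fun_prop
    filter_upwards [hcont.eventually_lt_const hεε, self_mem_nhdsWithin] with η hη hηS
    have hηd := hηS.1
    have hη1 := mem_unitDisk.mp hηd
    have hKη := hK η hηd
    have hρ := one_add_div_one_sub_norm_diskMap_le (mem_unitDisk.mp ha) hη1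
    have hre : (G a + (δ : ℂ)).re ≤ 2 * δ := by simp; linarith
    have hre0 : 0 ≤ (G a + (δ : ℂ)).re := by simpa using add_nonneg (hGnn a ha) hδ0.le
    have hst : ‖1 - η‖ ≤ M * (1 - ‖η‖ ^ 2) := by
      have h1 := hηS.2
      rw [div_lt_iff₀ (by linarith)] at h1
      exact h1.le.trans (mul_le_mul_of_nonneg_left (by nlinarith [norm_nonneg η]) hMpos.le)
    have hsa := hsq ha
    have hsη := hsq hηd
    have e1 : (1 - η) * G η =
        (1 - η) * (G η + (δ : ℂ) - (G a + (δ : ℂ)).im * Complex.I) - (1 - η) * b := by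
      rw [hb]; ring
    rw [dist_zero_right, e1]
    refine (norm_sub_le _ _).trans_lt (lt_of_le_of_lt ?_ hη)
    rw [norm_mul, norm_mul, add_comm]
    refine add_le_add le_rfl ?_
    calc ‖1 - η‖ * ‖G η + (δ : ℂ) - (G a + (δ : ℂ)).im * Complex.I‖
        ≤ (M * (1 - ‖η‖ ^ 2)) * (2 * δ *
          (4 * ‖1 - (starRingEnd ℂ) a * η‖ ^ 2 / ((1 - ‖a‖ ^ 2) * (1 - ‖η‖ ^ 2)))) :=
          mul_le_mul hst (hKη.trans (mul_le_mul hre hρ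
            (div_nonneg (by positivity) (by linarith [norm_diskMap_lt (mem_unitDisk.mp ha) hη1]))
            (by positivity))) (norm_nonneg _) (by positivity)
      _ = _ := by field_simp
  refine ⟨1 / B, by positivity, by rw [one_div_le hB0 hA0]; exact hAB, fun M => ?_⟩
  have hlim : Tendsto (fun η => (1 - η) * (H η + 1)) (𝓝[stolzRegion 1 M] 1) (𝓝 (2 * B)) := by
    have h1 : Tendsto (fun η : ℂ => (B : ℂ) * (1 + η) + (1 - η)) (𝓝[stolzRegion 1 M] 1)
        (𝓝 (B * (1 + 1) + (1 - 1))) :=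
      tendsto_nhdsWithin_of_tendsto_nhds (Continuous.tendsto (by fun_prop) _)
    have h2 := (hGlim M).add h1
    have e : (0 : ℂ) + (B * (1 + 1) + (1 - 1)) = 2 * B := by ring
    rw [e] at h2
    refine h2.congr' ?_
    filter_upwards [self_mem_nhdsWithin] with η hη
    have := one_sub_ne_zero_of_mem_unitDisk hη.1
    simp only [hG, hQ]
    field_simp
    ring
  have hBC : (B : ℂ) ≠ 0 := by exact_mod_cast hB0.ne'
  have h2 := (tendsto_const_nhds (x := 2 * τ)).div hlim (by simpa using hBC)
  have e : 2 * τ / (2 * (B : ℂ)) = ((1 / B : ℝ) : ℂ) * τ := by push_cast; field_simp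
  rw [e] at h2
  refine h2.congr' ?_
  filter_upwards [self_mem_nhdsWithin] with η hη
  have h3 := one_sub_ne_zero_of_mem_unitDisk hη.1
  have h4 := hne η hη.1
  have h5 : τ ≠ 0 := norm_ne_zero_iff.mp (by rw [hτ]; exact one_ne_zero)
  have h6 : H η + 1 = 2 * τ / (τ - φ η) := by simp only [hH]; field_simp; ring
  simp only [Pi.div_apply, h6]
  field_simp

/-! ### Derivatives of bounded families of holomorphic functions -/

/-- A bounded holomorphic function on a disk is approximated by its differential to second order,
with a constant that depends only on the bound. -/
theorem norm_slope_sub_deriv_le {h : ℂ → ℂ} {r K : ℝ} (hd : DifferentiableOn ℂ h (ball 0 r))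
    (hK : ∀ z ∈ ball (0 : ℂ) r, ‖h z‖ ≤ K) {z : ℂ} (hz : z ∈ ball (0 : ℂ) r) (hz0 : z ≠ 0) :
    ‖(h z - h 0) / z - deriv h 0‖ ≤ 4 * K / r ^ 2 * ‖z‖ := by
  have hr : 0 < r := nonempty_ball.mp ⟨z, hz⟩
  have h0 : (0 : ℂ) ∈ ball (0 : ℂ) r := mem_ball_self hr
  have hm : MapsTo h (ball 0 r) (closedBall (h 0) (2 * K)) := fun w hw => by
    rw [mem_closedBall, dist_eq_norm]
    linarith [norm_sub_le (h w) (h 0), hK w hw, hK 0 h0]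
  have hds := (Complex.differentiableOn_dslope (ball_mem_nhds (0 : ℂ) hr)).mpr hd
  have hb := fun w (hw : w ∈ ball (0 : ℂ) r) => Complex.norm_dslope_le_div_of_mapsTo_ball hd hm hw
  have hm2 : MapsTo (dslope h 0) (ball 0 r) (closedBall (dslope h 0 0) (4 * K / r)) :=
    fun w hw => by
      rw [mem_closedBall, dist_eq_norm]
      have := norm_sub_le (dslope h 0 w) (dslope h 0 0)
      have e : 4 * K / r = 2 * K / r + 2 * K / r := by ring
      linarith [hb w hw, hb 0 h0]
  have := Complex.dist_le_div_mul_dist_of_mapsTo_ball hds hm2 hz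
  rw [dist_eq_norm, dist_zero_right, dslope_same, dslope_of_ne _ hz0, slope_def_field,
    sub_zero] at this
  refine this.trans_eq ?_
  field_simp

/-- If a bounded family of holomorphic functions on a disk converges pointwise on a radius, to a
function `c`, then the derivatives at the center converge to the one-sided derivative of `c`. -/
theorem exists_tendsto_deriv {ι : Type*} {l : Filter ι} [NeBot l] {h : ι → ℂ → ℂ} {r K : ℝ}
    (hr : 0 < r) (hd : ∀ᶠ i in l, DifferentiableOn ℂ (h i) (ball 0 r))
    (hK : ∀ᶠ i in l, ∀ z ∈ ball (0 : ℂ) r, ‖h i z‖ ≤ K) {c : ℝ → ℂ}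
    (hc : ∀ δ ∈ Ico 0 r, Tendsto (fun i => h i (δ : ℂ)) l (𝓝 (c δ))) :
    ∃ L : ℂ, Tendsto (fun i => deriv (h i) 0) l (𝓝 L) ∧
      Tendsto (fun δ : ℝ => (c δ - c 0) / δ) (𝓝[>] 0) (𝓝 L) := by
  set C := 4 * K / r ^ 2 with hC
  have hK0 : 0 ≤ K := by
    obtain ⟨i, hi⟩ := hK.exists
    exact (norm_nonneg _).trans (hi 0 (mem_ball_self hr))
  have hC0 : 0 ≤ C := by positivity
  have hball : ∀ δ ∈ Ioo 0 r, (δ : ℂ) ∈ ball (0 : ℂ) r := fun δ hδ => by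
    rw [mem_ball_zero_iff, Complex.norm_real, Real.norm_of_nonneg hδ.1.le]; exact hδ.2
  have hest : ∀ δ ∈ Ioo 0 r, ∀ᶠ i in l,
      ‖(h i δ - h i 0) / δ - deriv (h i) 0‖ ≤ C * δ := fun δ hδ => by
    filter_upwards [hd, hK] with i hdi hKi
    have := norm_slope_sub_deriv_le hdi hKi (hball δ hδ) (by exact_mod_cast hδ.1.ne')
    rwa [Complex.norm_real, Real.norm_of_nonneg hδ.1.le] at this
  have hq : ∀ δ ∈ Ioo 0 r,
      Tendsto (fun i => (h i δ - h i 0) / δ) l (𝓝 ((c δ - c 0) / δ)) := fun δ hδ => by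
    have h1 := hc 0 ⟨le_rfl, hr⟩
    rw [Complex.ofReal_zero] at h1
    exact ((hc δ ⟨hδ.1.le, hδ.2⟩).sub h1).div_const _
  have hcau : Cauchy (map (fun i => deriv (h i) 0) l) := by
    rw [Metric.cauchy_iff]
    refine ⟨inferInstance, fun ε hε => ?_⟩
    obtain ⟨δ, hδ, hδε⟩ : ∃ δ ∈ Ioo 0 r, C * δ < ε / 4 := by
      refine ⟨min (r / 2) (ε / (8 * (C + 1))), ⟨by positivity, ?_⟩, ?_⟩
      · exact (min_le_left _ _).trans_lt (by linarith)
      · calc C * min (r / 2) (ε / (8 * (C + 1))) ≤ C * (ε / (8 * (C + 1))) :=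
              mul_le_mul_of_nonneg_left (min_le_right _ _) hC0
          _ < ε / 4 := by
            rw [← mul_div_assoc, div_lt_div_iff₀ (by positivity) (by norm_num)]
            nlinarith
    have hev : ∀ᶠ i in l, dist (deriv (h i) 0) ((c δ - c 0) / δ) < ε / 2 := by
      filter_upwards [hest δ hδ, Metric.tendsto_nhds.mp (hq δ hδ) (ε / 4) (by linarith)]
        with i h1 h2
      rw [← dist_eq_norm] at h1
      have := dist_triangle_left (deriv (h i) 0) ((c δ - c 0) / δ) ((h i δ - h i 0) / δ)
      linarith
    refine ⟨_, image_mem_map hev, ?_⟩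
    rintro _ ⟨i, hi, rfl⟩ _ ⟨j, hj, rfl⟩
    have := dist_triangle_right (deriv (h i) 0) (deriv (h j) 0) ((c δ - c 0) / δ)
    rw [mem_ofPred_eq] at hi hj
    linarith
  obtain ⟨L, hL⟩ := CompleteSpace.complete hcau
  refine ⟨L, hL, ?_⟩
  have hle : ∀ δ ∈ Ioo 0 r, ‖(c δ - c 0) / δ - L‖ ≤ C * δ := fun δ hδ =>
    le_of_tendsto ((hq δ hδ).sub hL).norm (hest δ hδ)
  rw [tendsto_iff_norm_sub_tendsto_zero]
  have hz : Tendsto (fun δ : ℝ => C * δ) (𝓝[>] 0) (𝓝 0) := by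
    have : Tendsto (fun δ : ℝ => C * δ) (𝓝 0) (𝓝 (C * 0)) := Continuous.tendsto (by fun_prop) _
    rw [mul_zero] at this
    exact tendsto_nhdsWithin_of_tendsto_nhds this
  refine squeeze_zero' (Eventually.of_forall fun _ => norm_nonneg _) ?_ hz
  filter_upwards [Ioo_mem_nhdsGT hr] with δ hδ using hle δ hδ

/-! ### Horospheres and Julia's lemma -/

theorem exp_two_mul_poincareDist {a b : ℂ} (h : ‖diskMap a b‖ < 1) :
    Real.exp (2 * poincareDist a b) = (1 + ‖diskMap a b‖) / (1 - ‖diskMap a b‖) := by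
  have h0 := norm_nonneg (diskMap a b)
  have h1 : 0 < 1 - ‖diskMap a b‖ := by linarith
  rw [poincareDist, ← mul_assoc, mul_one_div_cancel two_ne_zero, one_mul,
    Real.exp_log (by positivity)]

theorem poincareDist_zero_left (b : ℂ) :
    poincareDist 0 b = 1 / 2 * Real.log ((1 + ‖b‖) / (1 - ‖b‖)) := by
  simp [poincareDist, diskMap]

theorem kobayashiDist_zero_le {n : ℕ} {w : Fin n → ℂ} (hw : w ∈ polydisk n) :
    kobayashiDist (polydisk n) 0 w ≤ 1 / 2 * Real.log ((1 + ‖w‖) / (1 - ‖w‖)) := by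
  have h0 : (0 : Fin n → ℂ) ∈ polydisk n := mem_polydisk.mpr (by simp)
  have hw1 : ‖w‖ < 1 := mem_ball_zero_iff.mp hw
  have h1 : 0 < 1 - ‖w‖ := by linarith
  have hn := norm_nonneg w
  rw [kobayashiDist_polydisk h0 hw]
  refine Real.iSup_le (fun j => ?_) (mul_nonneg (by norm_num) (Real.log_nonneg ?_))
  · rw [Pi.zero_apply, poincareDist_zero_left]
    have hj := norm_le_pi_norm w j
    have h2 : 0 < 1 - ‖w j‖ := by linarith
    have := norm_nonneg (w j)
    gcongr
  · rw [le_div_iff₀ h1]; linarith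

theorem exists_norm_eq_one {n : ℕ} {x : Fin n → ℂ} (hx : ‖x‖ = 1) : ∃ j, ‖x j‖ = 1 := by
  by_contra! h
  have : ‖x‖ < 1 := (pi_norm_lt_iff one_pos).mpr fun j =>
    lt_of_le_of_ne (hx ▸ norm_le_pi_norm x j) (h j)
  exact this.ne hx

theorem norm_one_sub_conj_mul {a b : ℂ} (hb : ‖b‖ = 1) :
    ‖1 - (starRingEnd ℂ) a * b‖ = ‖b - a‖ := by
  have h : 1 - (starRingEnd ℂ) a * b = (starRingEnd ℂ) (b - a) * b := by
    rw [map_sub, sub_mul, Complex.conj_mul', hb]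
    simp
  rw [h, norm_mul, hb, mul_one, RCLike.norm_conj]

/-- In a component with `|p| = 1`, the Poincaré distance to points near `p` is controlled by the
horocycle of `p` that passes through `a`. -/
theorem eventually_poincareDist_le_of_norm_eq_one {p a : ℂ} {R : ℝ} (hp : ‖p‖ = 1) (ha : ‖a‖ < 1)
    (h : ‖p - a‖ ^ 2 < R * (1 - ‖a‖ ^ 2)) :
    ∀ᶠ b in 𝓝[unitDisk] p, poincareDist a b ≤ poincareDist 0 b + 1 / 2 * Real.log R := by
  have hsa : 0 < 1 - ‖a‖ ^ 2 := by nlinarith [norm_nonneg a]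
  have hR : 0 < R := pos_of_mul_pos_left ((sq_nonneg _).trans_lt h) hsa.le
  have hev : ∀ᶠ b in 𝓝[unitDisk] p,
      4 * ‖1 - (starRingEnd ℂ) a * b‖ ^ 2 < R * (1 + ‖b‖) ^ 2 * (1 - ‖a‖ ^ 2) := by
    refine nhdsWithin_le_nhds ((Continuous.continuousAt (by fun_prop)).eventually_lt
      (Continuous.continuousAt (by fun_prop)) ?_)
    rw [norm_one_sub_conj_mul hp, hp]
    linarith
  filter_upwards [hev, self_mem_nhdsWithin] with b hb hbd
  have hb1 := mem_unitDisk.mp hbd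
  have hρ := one_add_div_one_sub_norm_diskMap_le ha hb1
  have hn := norm_nonneg b
  have h1 : 0 < 1 - ‖b‖ := by linarith
  have hsb : 0 < 1 - ‖b‖ ^ 2 := by nlinarith
  rw [poincareDist_zero_left, ← mul_add, ← Real.log_mul (by positivity) hR.ne', poincareDist]
  have hd := norm_diskMap_lt ha hb1
  have hd0 := norm_nonneg (diskMap a b)
  refine mul_le_mul_of_nonneg_left (Real.log_le_log (div_pos (by linarith) (by linarith))
    (hρ.trans ?_)) (by norm_num)
  rw [div_mul_eq_mul_div, div_le_div_iff₀ (by positivity) h1]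
  nlinarith [mul_le_mul_of_nonneg_right hb.le h1.le]

theorem exists_eventually_poincareDist_le_of_norm_lt_one {p a : ℂ} (hp : ‖p‖ < 1) (ha : ‖a‖ < 1) :
    ∃ C : ℝ, ∀ᶠ b in 𝓝 p, poincareDist a b ≤ C := by
  have hc : ContinuousAt (fun b => poincareDist a b) p := by
    have hd := norm_diskMap_lt ha hp
    have h0 := norm_nonneg (diskMap a p)
    have h1 : ContinuousAt (fun b => ‖diskMap a b‖) p :=
      ((differentiableOn_diskMap ha).differentiableAt
        (isOpen_ball.mem_nhds (mem_unitDisk.mpr hp))).continuousAt.norm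
    have h2 : ContinuousAt (fun d : ℝ => 1 / 2 * Real.log ((1 + d) / (1 - d))) ‖diskMap a p‖ := by
      have h3 : ContinuousAt (fun d : ℝ => (1 + d) / (1 - d)) ‖diskMap a p‖ :=
        ContinuousAt.div (by fun_prop) (by fun_prop) (by linarith)
      exact (h3.log (div_pos (by linarith) (by linarith)).ne').const_mul _
    exact ContinuousAt.comp (f := fun b => ‖diskMap a b‖) h2 h1
  exact ⟨poincareDist a p + 1, (hc.eventually_lt_const (lt_add_one _)).mono fun _ h => h.le⟩

theorem tendsto_kobayashiDist_zero_atTop {n : ℕ} {x : Fin n → ℂ} (hx : ‖x‖ = 1) :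
    Tendsto (fun w => kobayashiDist (polydisk n) 0 w) (𝓝[polydisk n] x) atTop := by
  obtain ⟨j, hj⟩ := exists_norm_eq_one hx
  have h0 : (0 : Fin n → ℂ) ∈ polydisk n := mem_polydisk.mpr (by simp)
  have hlow : ∀ᶠ w in 𝓝[polydisk n] x, 1 / 2 * Real.log ((1 - ‖w j‖)⁻¹) ≤
      kobayashiDist (polydisk n) 0 w := by
    filter_upwards [self_mem_nhdsWithin] with w hw
    refine le_trans ?_ (poincareDist_le_kobayashiDist h0 hw j)
    have h1 := mem_polydisk.mp hw j
    have h2 : 0 < 1 - ‖w j‖ := by linarith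
    rw [Pi.zero_apply, poincareDist_zero_left, inv_eq_one_div]
    have := norm_nonneg (w j)
    gcongr
    linarith
  refine tendsto_atTop_mono' _ hlow ?_
  refine Tendsto.const_mul_atTop (by norm_num) (Real.tendsto_log_atTop.comp
    (tendsto_inv_nhdsGT_zero.comp (tendsto_nhdsWithin_iff.mpr ⟨?_, ?_⟩)))
  · have : Tendsto (fun w : Fin n → ℂ => 1 - ‖w j‖) (𝓝 x) (𝓝 (1 - ‖x j‖)) :=
      Continuous.tendsto (by fun_prop) _
    rw [hj, sub_self] at this
    exact tendsto_nhdsWithin_of_tendsto_nhds this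
  · filter_upwards [self_mem_nhdsWithin] with w hw
    exact sub_pos.mpr (mem_polydisk.mp hw j)

theorem mem_horosphere_of_lt {n : ℕ} {x z : Fin n → ℂ} {R : ℝ} (hx : ‖x‖ = 1)
    (hz : z ∈ polydisk n)
    (h : ∀ j, ‖x j‖ = 1 → ‖x j - z j‖ ^ 2 < R * (1 - ‖z j‖ ^ 2)) : z ∈ horosphere x R := by
  obtain ⟨j₀, hj₀⟩ := exists_norm_eq_one hx
  have hz' := mem_polydisk.mp hz
  have hR : 0 < R := by
    have h1 : 0 < 1 - ‖z j₀‖ ^ 2 := by nlinarith [norm_nonneg (z j₀), hz' j₀]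
    exact pos_of_mul_pos_left ((sq_nonneg _).trans_lt (h j₀ hj₀)) h1.le
  obtain ⟨R', hR'0, hR'R, hR'⟩ : ∃ R' : ℝ, 0 < R' ∧ R' < R ∧
      ∀ j, ‖x j‖ = 1 → ‖x j - z j‖ ^ 2 < R' * (1 - ‖z j‖ ^ 2) := by
    have h1 : ∀ᶠ R' in 𝓝[<] R, ∀ j, ‖x j‖ = 1 → ‖x j - z j‖ ^ 2 < R' * (1 - ‖z j‖ ^ 2) := by
      refine nhdsWithin_le_nhds (eventually_all.mpr fun j => ?_)
      by_cases hj : ‖x j‖ = 1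
      · have : ∀ᶠ R' in 𝓝 R, ‖x j - z j‖ ^ 2 < R' * (1 - ‖z j‖ ^ 2) :=
          Tendsto.eventually_const_lt (h j hj)
            (Continuous.tendsto (f := fun R' : ℝ => R' * (1 - ‖z j‖ ^ 2)) (by fun_prop) R)
        exact this.mono fun _ h _ => h
      · exact Eventually.of_forall fun _ h => absurd h hj
    obtain ⟨R', h2, h3, h4⟩ := (h1.and ((show ∀ᶠ R' in 𝓝[<] R, 0 < R' from
      nhdsWithin_le_nhds (Ioi_mem_nhds hR)).and self_mem_nhdsWithin)).exists
    exact ⟨R', h3, h4, h2⟩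
  refine ⟨hz, lt_of_le_of_lt (b := ((1 / 2 * Real.log R' : ℝ) : EReal)) ?_ ?_⟩
  swap
  · have := Real.log_lt_log hR'0 hR'R
    exact_mod_cast (by linarith : 1 / 2 * Real.log R' < 1 / 2 * Real.log R)
  have h0 : (0 : Fin n → ℂ) ∈ polydisk n := mem_polydisk.mpr (by simp)
  have hj : ∀ j, Tendsto (fun w : Fin n → ℂ => w j) (𝓝[polydisk n] x) (𝓝[unitDisk] (x j)) :=
    fun j => tendsto_nhdsWithin_iff.mpr
      ⟨tendsto_nhdsWithin_of_tendsto_nhds (Continuous.tendsto (continuous_apply j) _),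
        eventually_mem_nhdsWithin.mono fun w hw => mem_unitDisk.mpr (mem_polydisk.mp hw j)⟩
  have hev : ∀ᶠ w in 𝓝[polydisk n] x, ∀ j,
      poincareDist (z j) (w j) ≤ kobayashiDist (polydisk n) 0 w + 1 / 2 * Real.log R' := by
    refine eventually_all.mpr fun j => ?_
    rcases eq_or_lt_of_le (hx ▸ norm_le_pi_norm x j : ‖x j‖ ≤ 1) with hj1 | hj1
    · filter_upwards [(hj j).eventually
        (eventually_poincareDist_le_of_norm_eq_one hj1 (hz' j) (hR' j hj1)),
        self_mem_nhdsWithin] with w h1 hw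
      have := poincareDist_le_kobayashiDist h0 hw j
      rw [Pi.zero_apply] at this
      linarith
    · obtain ⟨C, hC⟩ := exists_eventually_poincareDist_le_of_norm_lt_one hj1 (hz' j)
      filter_upwards [((hj j).mono_right nhdsWithin_le_nhds).eventually hC,
        (tendsto_kobayashiDist_zero_atTop hx).eventually_ge_atTop (C - 1 / 2 * Real.log R')]
        with w h1 h2
      linarith
  refine limsup_le_of_le (h := ?_)
  filter_upwards [hev, self_mem_nhdsWithin] with w h1 hw
  rw [EReal.coe_le_coe_iff, kobayashiDist_polydisk hz hw, sub_le_iff_le_add']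
  have : Nonempty (Fin n) := ⟨j₀⟩
  exact ciSup_le h1

/-- If the lower limit is a real number, an ultrafilter finer than the given filter realizes it. -/
theorem exists_ultrafilter_tendsto_of_liminf_eq {X : Type*} {F : Filter X} {u : X → ℝ} {α : ℝ}
    (h : liminf (fun w => ((u w : ℝ) : EReal)) F = (α : EReal)) :
    ∃ U : Ultrafilter X, (U : Filter X) ≤ F ∧ Tendsto u U (𝓝 α) := by
  have hne : NeBot (F ⊓ comap u (𝓝 α)) := by
    refine inf_neBot_iff.mpr fun {s} hs {t} ht => ?_
    obtain ⟨v, hv, hvt⟩ := mem_comap.mp ht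
    obtain ⟨ε, hε, hεv⟩ := Metric.mem_nhds_iff.mp hv
    have h1 : ∃ᶠ w in F, ((u w : ℝ) : EReal) < ((α + ε : ℝ) : EReal) :=
      frequently_lt_of_liminf_lt (h := by
        rw [h]; exact_mod_cast (by linarith : α < α + ε))
    have h2 : ∀ᶠ w in F, ((α - ε : ℝ) : EReal) < ((u w : ℝ) : EReal) :=
      eventually_lt_of_lt_liminf (by rw [h]; exact_mod_cast (by linarith : α - ε < α))
    obtain ⟨w, ⟨hw1, hw2⟩, hw3⟩ := ((h1.and_eventually h2).and_eventually hs).exists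
    refine ⟨w, hw3, hvt (hεv ?_)⟩
    rw [mem_ball, Real.dist_eq, abs_sub_lt_iff]
    rw [EReal.coe_lt_coe_iff] at hw1 hw2
    constructor <;> linarith
  refine ⟨Ultrafilter.of (F ⊓ comap u (𝓝 α)), (Ultrafilter.of_le _).trans inf_le_left, ?_⟩
  exact tendsto_comap.mono_left ((Ultrafilter.of_le _).trans inf_le_right)

/-- Julia's lemma: there is a boundary point `τ` such that `f` maps the horosphere of center `x` and
radius `R` into the closed horodisk of center `τ` and radius `α R`. -/
theorem exists_julia {n : ℕ} {f : (Fin n → ℂ) → ℂ} (hf : DifferentiableOn ℂ f (polydisk n))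
    (hmaps : MapsTo f (polydisk n) unitDisk) {x : Fin n → ℂ} (hx : ‖x‖ = 1) {α : ℝ}
    (hα : liminf (fun w => (((1 - ‖f w‖) / (1 - ‖w‖) : ℝ) : EReal)) (𝓝[polydisk n] x) =
      (α : EReal)) :
    ∃ τ : ℂ, ‖τ‖ = 1 ∧ ∀ R : ℝ, 0 < R → ∀ z ∈ horosphere x R,
      ‖τ - f z‖ ^ 2 ≤ α * R * (1 - ‖f z‖ ^ 2) := by
  obtain ⟨U, hUF, hU⟩ := exists_ultrafilter_tendsto_of_liminf_eq hα
  have hUm : ∀ᶠ w in (U : Filter _), w ∈ polydisk n := hUF self_mem_nhdsWithin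
  obtain ⟨τ, -, hτU⟩ := (isCompact_closedBall (0 : ℂ) 1).ultrafilter_le_nhds (U.map f) (by
    rw [Filter.le_principal_iff]
    exact hUm.mono fun w hw => by
      simpa using (mem_unitDisk.mp (hmaps hw)).le)
  have hfU : Tendsto f U (𝓝 τ) := hτU
  have hnU : Tendsto (fun w : Fin n → ℂ => ‖w‖) U (𝓝 1) := by
    have : Tendsto (fun w : Fin n → ℂ => ‖w‖) (𝓝 x) (𝓝 ‖x‖) := continuous_norm.tendsto _
    rw [hx] at this
    exact this.mono_left (hUF.trans nhdsWithin_le_nhds)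
  have hτ : ‖τ‖ = 1 := by
    have h1 : Tendsto (fun w => (1 - ‖f w‖) / (1 - ‖w‖) * (1 - ‖w‖)) U (𝓝 (α * (1 - 1))) :=
      hU.mul (hnU.const_sub 1)
    have h2 : Tendsto (fun w => (1 - ‖f w‖) / (1 - ‖w‖) * (1 - ‖w‖)) U (𝓝 (1 - ‖τ‖)) := by
      refine (hfU.norm.const_sub 1).congr' ?_
      filter_upwards [hUm] with w hw
      have : 1 - ‖w‖ ≠ 0 := by linarith [mem_ball_zero_iff.mp hw]
      rw [div_mul_cancel₀ _ this]
    have := tendsto_nhds_unique h1 h2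
    linarith
  refine ⟨τ, hτ, fun R hR z hz => ?_⟩
  obtain ⟨hz, hlim⟩ := hz
  have hev := eventually_lt_of_limsup_lt hlim
  have hfz := mem_unitDisk.mp (hmaps hz)
  have hsq : 0 < 1 - ‖f z‖ ^ 2 := by nlinarith [norm_nonneg (f z)]
  have hne : τ - f z ≠ 0 := fun h => by
    rw [← sub_eq_zero.mp h, hτ] at hfz; exact lt_irrefl _ hfz
  -- Contraction of the Kobayashi distance, with the boundary distances cleared.
  have key : ∀ᶠ w in (U : Filter _),
      (1 + ‖diskMap (f z) (f w)‖) ^ 2 * ‖1 - (starRingEnd ℂ) (f z) * f w‖ ^ 2 ≤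
        R * (1 + ‖w‖) * ((1 - ‖f w‖) / (1 - ‖w‖)) * ((1 - ‖f z‖ ^ 2) * (1 + ‖f w‖)) := by
    filter_upwards [hUF hev, hUm] with w hw hwp
    rw [EReal.coe_lt_coe_iff] at hw
    have hw1 : ‖w‖ < 1 := mem_ball_zero_iff.mp hwp
    have hfw := mem_unitDisk.mp (hmaps hwp)
    have h1 := poincareDist_map_le_kobayashiDist hf hmaps hz hwp
    have h2 := kobayashiDist_zero_le hwp
    have hd := norm_diskMap_lt hfz hfw
    have hwn := norm_nonneg w
    have hw0 : 0 < 1 - ‖w‖ := by linarith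
    have h3 : Real.exp (2 * poincareDist (f z) (f w)) ≤ (1 + ‖w‖) / (1 - ‖w‖) * R := by
      rw [← Real.exp_log (show 0 < (1 + ‖w‖) / (1 - ‖w‖) * R by positivity),
        Real.log_mul (by positivity) hR.ne']
      exact Real.exp_le_exp.mpr (by linarith)
    rw [exp_two_mul_poincareDist hd] at h3
    have hk := one_sub_diskMap_sq hfz hfw
    have hden := norm_pos_iff.mpr (diskMap_den_ne hfz hfw)
    have hd0 := norm_nonneg (diskMap (f z) (f w))
    have hfwn := norm_nonneg (f w)
    generalize ‖diskMap (f z) (f w)‖ = d at *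
    generalize ‖1 - (starRingEnd ℂ) (f z) * f w‖ = q at *
    have hd1 : 0 < 1 - d := by linarith
    have hfw0 : 0 < 1 - ‖f w‖ := by linarith
    have h4 : (1 - d) * (1 + d) * q ^ 2 = (1 - ‖f z‖ ^ 2) * ((1 - ‖f w‖) * (1 + ‖f w‖)) := by
      have h5 : (1 - d) * (1 + d) = 1 - d ^ 2 := by ring
      have h6 : (1 - ‖f w‖) * (1 + ‖f w‖) = 1 - ‖f w‖ ^ 2 := by ring
      rw [h5, h6, hk]; field_simp
    have h5 : (1 + d) ^ 2 * q ^ 2 =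
        (1 + d) / (1 - d) * ((1 - ‖f z‖ ^ 2) * ((1 - ‖f w‖) * (1 + ‖f w‖))) := by
      rw [← h4]; field_simp
    rw [h5]
    refine (mul_le_mul_of_nonneg_right h3 (by positivity)).trans_eq ?_
    field_simp
  have hdU : Tendsto (fun w => ‖diskMap (f z) (f w)‖) U (𝓝 1) := by
    have hden : 1 - (starRingEnd ℂ) (f z) * τ ≠ 0 := by
      rw [← norm_ne_zero_iff, norm_one_sub_conj_mul hτ]; exact norm_ne_zero_iff.mpr hne
    have h1 : Tendsto (fun w => ‖diskMap (f z) (f w)‖) U (𝓝 ‖diskMap (f z) τ‖) :=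
      ((hfU.sub_const _).div ((hfU.const_mul _).const_sub _) hden).norm
    rwa [diskMap, norm_div, norm_one_sub_conj_mul hτ, div_self (norm_ne_zero_iff.mpr hne)] at h1
  have hL := ((hdU.const_add 1).pow 2).mul ((hfU.const_mul ((starRingEnd ℂ) (f z))).const_sub
    1 |>.norm.pow 2)
  have hRt := (((hnU.const_add 1).const_mul R).mul hU).mul
    ((hfU.norm.const_add 1).const_mul (1 - ‖f z‖ ^ 2))
  have := le_of_tendsto_of_tendsto hL hRt key
  rw [norm_one_sub_conj_mul hτ, hτ] at this
  linarith

/-! ### Complex geodesics through the boundary point -/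

/-- Componentwise, `boundaryDisk x β δ η` is `(η + δ β (1 - η)) x`. For `β` with values in `[0, 1]`
and `δ ∈ [0, 1)` this is an analytic disk in the polydisk that ends at `x` when `η` tends to `1`; it
leaves the geodesic of `x` in the direction `β x`, with speed proportional to `δ (1 - η)`. -/
def boundaryDisk {n : ℕ} (x : Fin n → ℂ) (β : Fin n → ℝ) (δ : ℝ) (η : ℂ) : Fin n → ℂ :=
  fun j => (η + (1 - η) * (δ * β j : ℝ)) * x j

theorem norm_add_one_sub_mul_le {η : ℂ} {μ : ℝ} (h0 : 0 ≤ μ) (h1 : μ ≤ 1) :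
    ‖η + (1 - η) * (μ : ℂ)‖ ≤ (1 - μ) * ‖η‖ + μ := by
  have e : η + (1 - η) * (μ : ℂ) = ((1 - μ : ℝ) : ℂ) * η + μ := by push_cast; ring
  rw [e]
  refine (norm_add_le _ _).trans_eq ?_
  rw [norm_mul, Complex.norm_real, Complex.norm_real, Real.norm_of_nonneg h0,
    Real.norm_of_nonneg (by linarith)]

section BoundaryDisk

variable {n : ℕ} {x : Fin n → ℂ} {β : Fin n → ℝ} {δ : ℝ}

theorem mul_nonneg_and_mul_le (hβ : ∀ j, β j ∈ Icc (0 : ℝ) 1) (hδ : δ ∈ Ico (0 : ℝ) 1) (j : Fin n) :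
    0 ≤ δ * β j ∧ δ * β j ≤ δ := by
  obtain ⟨h1, h2⟩ := hβ j
  exact ⟨mul_nonneg hδ.1 h1, mul_le_of_le_one_right hδ.1 h2⟩

theorem le_one_sub_norm_boundaryDisk (hx : ‖x‖ = 1) (hβ : ∀ j, β j ∈ Icc (0 : ℝ) 1)
    (hδ : δ ∈ Ico (0 : ℝ) 1) {η : ℂ} (hη : ‖η‖ < 1) (j : Fin n) :
    (1 - δ) * (1 - ‖η‖) ≤ 1 - ‖boundaryDisk x β δ η j‖ := by
  obtain ⟨h1, h2⟩ := mul_nonneg_and_mul_le hβ hδ j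
  have h3 := norm_add_one_sub_mul_le (η := η) h1 (h2.trans hδ.2.le)
  have h4 : ‖x j‖ ≤ 1 := hx ▸ norm_le_pi_norm x j
  rw [boundaryDisk, norm_mul]
  have h5 := mul_le_of_le_one_right (norm_nonneg (η + (1 - η) * (δ * β j : ℝ))) h4
  nlinarith

theorem boundaryDisk_mem_polydisk (hx : ‖x‖ = 1) (hβ : ∀ j, β j ∈ Icc (0 : ℝ) 1)
    (hδ : δ ∈ Ico (0 : ℝ) 1) {η : ℂ} (hη : η ∈ unitDisk) :
    boundaryDisk x β δ η ∈ polydisk n := mem_polydisk.mpr fun j => by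
  have h1 := le_one_sub_norm_boundaryDisk hx hβ hδ (mem_unitDisk.mp hη) j
  have h2 := mul_pos (sub_pos.mpr hδ.2) (sub_pos.mpr (mem_unitDisk.mp hη))
  linarith

theorem differentiable_boundaryDisk : Differentiable ℂ (boundaryDisk x β δ) :=
  differentiable_pi.mpr fun j => by unfold boundaryDisk; fun_prop

/-- The disks `boundaryDisk x β δ` enter the horospheres of center `x` at least as fast as the
geodesic of `x`. -/
theorem boundaryDisk_mem_horosphere (hx : ‖x‖ = 1) (hβ : ∀ j, β j ∈ Icc (0 : ℝ) 1)
    (hδ : δ ∈ Ico (0 : ℝ) 1) {η : ℂ} (hη : η ∈ unitDisk) {R : ℝ}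
    (hR : ‖1 - η‖ ^ 2 < R * (1 - ‖η‖ ^ 2)) : boundaryDisk x β δ η ∈ horosphere x R := by
  refine mem_horosphere_of_lt hx (boundaryDisk_mem_polydisk hx hβ hδ hη) fun j hj => ?_
  obtain ⟨h1, h2⟩ := mul_nonneg_and_mul_le hβ hδ j
  have hη1 := mem_unitDisk.mp hη
  have h3 := norm_add_one_sub_mul_le (η := η) h1 (h2.trans hδ.2.le)
  have h4 : 0 < 1 - δ * β j := by linarith [hδ.2]
  set μ := δ * β j with hμ
  have hn := norm_nonneg η
  have hsq : 0 < 1 - ‖η‖ ^ 2 := by nlinarith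
  have hR0 : 0 < R := pos_of_mul_pos_left ((sq_nonneg _).trans_lt hR) hsq.le
  have e : ‖x j - boundaryDisk x β δ η j‖ = (1 - μ) * ‖1 - η‖ := by
    have : x j - boundaryDisk x β δ η j = ((1 - μ : ℝ) : ℂ) * (1 - η) * x j := by
      rw [boundaryDisk, ← hμ]; push_cast; ring
    rw [this, norm_mul, norm_mul, hj, mul_one, Complex.norm_real, Real.norm_of_nonneg h4.le]
  have h5 : (1 - μ) * (1 - ‖η‖ ^ 2) ≤ 1 - ‖boundaryDisk x β δ η j‖ ^ 2 := by
    rw [boundaryDisk, norm_mul, hj, mul_one, ← hμ]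
    have h6 := pow_le_pow_left₀ (norm_nonneg _) h3 2
    -- Convexity of the square.
    nlinarith [mul_nonneg (mul_nonneg h1 h4.le) (sq_nonneg (1 - ‖η‖))]
  rw [e]
  calc ((1 - μ) * ‖1 - η‖) ^ 2 = (1 - μ) ^ 2 * ‖1 - η‖ ^ 2 := by ring
    _ < (1 - μ) ^ 2 * (R * (1 - ‖η‖ ^ 2)) := by gcongr
    _ ≤ (1 - μ) * (R * (1 - ‖η‖ ^ 2)) := by
      refine mul_le_mul_of_nonneg_right ?_ (by positivity)
      nlinarith
    _ = R * ((1 - μ) * (1 - ‖η‖ ^ 2)) := by ring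
    _ ≤ _ := mul_le_mul_of_nonneg_left h5 hR0.le

/-- Along `boundaryDisk x β δ` the function `f` has a finite angular derivative. -/
theorem exists_angular_derivative_boundaryDisk {f : (Fin n → ℂ) → ℂ}
    (hf : DifferentiableOn ℂ f (polydisk n)) (hmaps : MapsTo f (polydisk n) unitDisk)
    (hx : ‖x‖ = 1) {τ : ℂ} (hτ : ‖τ‖ = 1) {α : ℝ}
    (hJ : ∀ R : ℝ, 0 < R → ∀ z ∈ horosphere x R, ‖τ - f z‖ ^ 2 ≤ α * R * (1 - ‖f z‖ ^ 2))
    (hβ : ∀ j, β j ∈ Icc (0 : ℝ) 1) (hδ : δ ∈ Ico (0 : ℝ) 1) :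
    ∃ c : ℝ, 0 < c ∧ c ≤ α ∧ ∀ M : ℝ,
      Tendsto (fun η => (τ - f (boundaryDisk x β δ η)) / (1 - η))
        (𝓝[stolzRegion 1 M] 1) (𝓝 (c * τ)) := by
  have hm : MapsTo (boundaryDisk x β δ) unitDisk (polydisk n) := fun η hη =>
    boundaryDisk_mem_polydisk hx hβ hδ hη
  refine exists_angular_derivative (φ := f ∘ boundaryDisk x β δ)
    (hf.comp differentiable_boundaryDisk.differentiableOn hm) (hmaps.comp hm) hτ fun η hη => ?_
  have h1 : 0 < 1 - ‖η‖ ^ 2 := by nlinarith [norm_nonneg η, mem_unitDisk.mp hη]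
  have h2 : 0 < ‖1 - η‖ := norm_pos_iff.mpr (one_sub_ne_zero_of_mem_unitDisk hη)
  -- Julia's lemma holds in every horosphere larger than the one through the point.
  have h3 : ∀ R, ‖1 - η‖ ^ 2 / (1 - ‖η‖ ^ 2) < R →
      ‖τ - f (boundaryDisk x β δ η)‖ ^ 2 ≤ α * R * (1 - ‖f (boundaryDisk x β δ η)‖ ^ 2) :=
    fun R hR => hJ R ((by positivity : (0 : ℝ) < ‖1 - η‖ ^ 2 / (1 - ‖η‖ ^ 2)).trans hR) _
      (boundaryDisk_mem_horosphere hx hβ hδ hη ((div_lt_iff₀ h1).mp hR))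
  have h4 : Tendsto (fun R => α * R * (1 - ‖f (boundaryDisk x β δ η)‖ ^ 2))
      (𝓝[>] (‖1 - η‖ ^ 2 / (1 - ‖η‖ ^ 2))) (𝓝 (α * (‖1 - η‖ ^ 2 / (1 - ‖η‖ ^ 2)) *
        (1 - ‖f (boundaryDisk x β δ η)‖ ^ 2))) :=
    tendsto_nhdsWithin_of_tendsto_nhds (Continuous.tendsto (by fun_prop) _)
  have h5 := ge_of_tendsto h4 (eventually_mem_nhdsWithin.mono h3)
  simp only [Function.comp_apply]
  refine (mul_le_mul_of_nonneg_right h5 h1.le).trans_eq ?_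
  field_simp

end BoundaryDisk

theorem tendsto_ofReal_stolzRegion : Tendsto (fun t : ℝ => (t : ℂ)) (𝓝[<] 1)
    (𝓝[stolzRegion 1 2] 1) := by
  refine tendsto_nhdsWithin_iff.mpr ⟨?_, ?_⟩
  · have : Tendsto (fun t : ℝ => (t : ℂ)) (𝓝 1) (𝓝 ((1 : ℝ) : ℂ)) :=
      Complex.continuous_ofReal.tendsto _
    rw [Complex.ofReal_one] at this
    exact tendsto_nhdsWithin_of_tendsto_nhds this
  · filter_upwards [Ioo_mem_nhdsLT (zero_lt_one (α := ℝ))] with t ht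
    have h1 : ‖(t : ℂ)‖ = t := by rw [Complex.norm_real, Real.norm_of_nonneg ht.1.le]
    have h2 : ‖1 - (t : ℂ)‖ = 1 - t := by
      rw [← Complex.ofReal_one, ← Complex.ofReal_sub, Complex.norm_real,
        Real.norm_of_nonneg (by linarith [ht.2])]
    refine ⟨mem_unitDisk.mpr (h1.trans_lt ht.2), ?_⟩
    rw [h1, h2, div_self (by linarith [ht.2])]
    norm_num

/-- The angular derivative of `f` along the geodesic of `x` is the boundary dilation
coefficient. -/
theorem tendsto_geodesic {n : ℕ} {x : Fin n → ℂ} {f : (Fin n → ℂ) → ℂ}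
    (hf : DifferentiableOn ℂ f (polydisk n)) (hmaps : MapsTo f (polydisk n) unitDisk)
    (hx : ‖x‖ = 1) {τ : ℂ} (hτ : ‖τ‖ = 1) {α : ℝ}
    (hα : liminf (fun w => (((1 - ‖f w‖) / (1 - ‖w‖) : ℝ) : EReal)) (𝓝[polydisk n] x) =
      (α : EReal))
    (hJ : ∀ R : ℝ, 0 < R → ∀ z ∈ horosphere x R, ‖τ - f z‖ ^ 2 ≤ α * R * (1 - ‖f z‖ ^ 2))
    (M : ℝ) :
    Tendsto (fun η : ℂ => (τ - f (η • x)) / (1 - η)) (𝓝[stolzRegion 1 M] 1) (𝓝 (α * τ)) := by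
  obtain ⟨c, hc0, hcα, hc⟩ := exists_angular_derivative_boundaryDisk (β := fun _ => 0) (δ := 0) hf
    hmaps hx hτ hJ (fun _ => ⟨le_rfl, zero_le_one⟩) ⟨le_rfl, zero_lt_one⟩
  have hb : ∀ η : ℂ, boundaryDisk x (fun _ => 0) 0 η = η • x := fun η => by
    ext j; simp [boundaryDisk]
  simp only [hb] at hc
  suffices h : α ≤ c by rw [le_antisymm h hcα]; exact hc M
  have hlim := ((hc 2).comp tendsto_ofReal_stolzRegion).norm
  rw [norm_mul, hτ, mul_one, Complex.norm_real, Real.norm_of_nonneg hc0.le] at hlim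
  have hcurve : Tendsto (fun t : ℝ => (t : ℂ) • x) (𝓝[<] 1) (𝓝[polydisk n] x) := by
    have h1 : ∀ᶠ t : ℝ in 𝓝[<] 1, (t : ℂ) ∈ stolzRegion 1 2 :=
      tendsto_ofReal_stolzRegion.eventually self_mem_nhdsWithin
    refine tendsto_nhdsWithin_iff.mpr ⟨?_, h1.mono fun t ht => ?_⟩
    · have h2 : Tendsto (fun η : ℂ => η • x) (𝓝 1) (𝓝 ((1 : ℂ) • x)) :=
        Continuous.tendsto (by fun_prop) _
      rw [one_smul] at h2
      exact h2.comp (tendsto_ofReal_stolzRegion.mono_right nhdsWithin_le_nhds)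
    · rw [polydisk, mem_ball_zero_iff, norm_smul, hx, mul_one]
      exact mem_unitDisk.mp ht.1
  refine le_of_forall_pos_lt_add fun ε hε => ?_
  by_contra! hcon
  have h1 : ∀ᶠ w in 𝓝[polydisk n] x,
      (((α - ε / 2 : ℝ)) : EReal) < (((1 - ‖f w‖) / (1 - ‖w‖) : ℝ) : EReal) :=
    eventually_lt_of_lt_liminf (by rw [hα]; exact_mod_cast (by linarith : α - ε / 2 < α))
  obtain ⟨t, ⟨ht1, ht2⟩, ht3⟩ := (((hcurve.eventually h1).and (hlim.eventually_lt_const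
    (show c < c + ε / 2 by linarith))).and (Ioo_mem_nhdsLT (zero_lt_one (α := ℝ)))).exists
  have h2 : ‖(t : ℂ)‖ = t := by rw [Complex.norm_real, Real.norm_of_nonneg ht3.1.le]
  have h3 : ‖1 - (t : ℂ)‖ = 1 - t := by
    rw [← Complex.ofReal_one, ← Complex.ofReal_sub, Complex.norm_real,
      Real.norm_of_nonneg (by linarith [ht3.2])]
  have h4 : 0 < 1 - t := by linarith [ht3.2]
  rw [EReal.coe_lt_coe_iff, norm_smul, hx, mul_one, h2] at ht1
  simp only [Function.comp_apply, norm_div, h3] at ht2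
  have h5 : (1 - ‖f ((t : ℂ) • x)‖) / (1 - t) ≤ ‖τ - f ((t : ℂ) • x)‖ / (1 - t) := by
    have := norm_sub_norm_le τ (f ((t : ℂ) • x))
    rw [hτ] at this
    gcongr
  linarith

/-! ### Special and restricted curves -/

theorem silovDegree_ne_zero {n : ℕ} {x : Fin n → ℂ} (hx : ‖x‖ = 1) : silovDegree x ≠ 0 := by
  obtain ⟨j, hj⟩ := exists_norm_eq_one hx
  exact Finset.card_ne_zero_of_mem (Finset.mem_filter.mpr ⟨Finset.mem_univ j, hj⟩)

theorem leftInv_self {n : ℕ} {x : Fin n → ℂ} (hx : ‖x‖ = 1) : leftInv x x = 1 := by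
  have h : ∀ j, x j * (starRingEnd ℂ) (silovPart x j) = if ‖x j‖ = 1 then 1 else 0 := fun j => by
    unfold silovPart
    split_ifs with hj
    · rw [Complex.mul_conj', hj]; simp
    · simp
  rw [leftInv, Finset.sum_congr rfl fun j _ => h j, Finset.sum_boole, ← silovDegree]
  exact one_div_mul_cancel (by exact_mod_cast silovDegree_ne_zero hx)

theorem continuous_leftInv {n : ℕ} (x : Fin n → ℂ) : Continuous (leftInv x) := by
  unfold leftInv; fun_prop

/-- What the definition of a special and restricted curve says in terms of its components: the
projection tends to `1` in a Stolz region, the components are pseudohyperbolically close to those of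
the projection, and for the components with `|x_j| = 1` the Euclidean distance is small compared
with the distance to the boundary. -/
theorem exists_stolz_of_isSpecial {n : ℕ} {x : Fin n → ℂ} (hx : ‖x‖ = 1) {σ : ℝ → Fin n → ℂ}
    (hc : IsCurveTo x σ) (hs : IsSpecial x σ) (hr : IsRestricted x σ) :
    ∃ M : ℝ, 1 < M ∧ Tendsto (fun t => leftInv x (σ t)) (𝓝[<] 1) (𝓝[stolzRegion 1 M] 1) ∧
      (∀ᶠ t in 𝓝[<] 1, σ t ∈ polydisk n) ∧
      (∀ j, Tendsto (fun t => diskMap (leftInv x (σ t) * x j) (σ t j)) (𝓝[<] 1) (𝓝 0)) ∧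
      ∀ j, ‖x j‖ = 1 → Tendsto (fun t => ‖σ t j - leftInv x (σ t) * x j‖ / (1 - ‖leftInv x (σ t)‖))
        (𝓝[<] 1) (𝓝 0) := by
  obtain ⟨-, hmaps, hlim⟩ := hc
  obtain ⟨M, hM, hst⟩ := hr
  have hσ : ∀ᶠ t in 𝓝[<] (1 : ℝ), σ t ∈ polydisk n :=
    (show ∀ᶠ t in 𝓝[<] (1 : ℝ), t ∈ Ico (0 : ℝ) 1 from Ico_mem_nhdsLT zero_lt_one).mono
      fun t ht => hmaps ht
  have hle : ∀ᶠ t in 𝓝[<] (1 : ℝ), ∀ j, ‖leftInv x (σ t) * x j‖ < 1 ∧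
      ‖leftInv x (σ t) * x j‖ ≤ ‖leftInv x (σ t)‖ := by
    filter_upwards [hst] with t ht j
    have h1 := mem_unitDisk.mp ht.1
    have h2 : ‖leftInv x (σ t) * x j‖ ≤ ‖leftInv x (σ t)‖ := by
      rw [norm_mul]
      exact mul_le_of_le_one_right (norm_nonneg _) (hx ▸ norm_le_pi_norm x j)
    exact ⟨h2.trans_lt h1, h2⟩
  have hd : ∀ j, Tendsto (fun t => diskMap (leftInv x (σ t) * x j) (σ t j)) (𝓝[<] 1) (𝓝 0) := by
    intro j
    have h2 := hs.const_mul 2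
    rw [mul_zero] at h2
    refine squeeze_zero_norm' ?_ h2
    filter_upwards [hσ, hle] with t h1 h3
    have h4 : retraction x (σ t) ∈ polydisk n := mem_polydisk.mpr fun j => (h3 j).1
    have h5 := poincareDist_le_kobayashiDist h1 h4 j
    have h6 := half_norm_diskMap_le_poincareDist
      (norm_diskMap_lt (mem_polydisk.mp h1 j) (mem_polydisk.mp h4 j))
    rw [norm_diskMap_comm]
    have h7 : retraction x (σ t) j = leftInv x (σ t) * x j := rfl
    rw [h7] at h5 h6
    linarith
  refine ⟨M, hM, tendsto_nhdsWithin_iff.mpr ⟨?_, hst⟩, hσ, hd, fun j hj => ?_⟩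
  · have := ((continuous_leftInv x).tendsto x).comp hlim
    rwa [leftInv_self hx] at this
  · have h1 : Tendsto (fun t => 2 * ‖diskMap (leftInv x (σ t) * x j) (σ t j)‖ /
        (1 - ‖diskMap (leftInv x (σ t) * x j) (σ t j)‖)) (𝓝[<] 1) (𝓝 (2 * ‖(0 : ℂ)‖ /
        (1 - ‖(0 : ℂ)‖))) :=
      ((hd j).norm.const_mul 2).div ((hd j).norm.const_sub 1) (by simp)
    rw [norm_zero, mul_zero, zero_div] at h1
    refine squeeze_zero' ?_ ?_ h1
    · filter_upwards [hst] with t ht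
      exact div_nonneg (norm_nonneg _) (by linarith [mem_unitDisk.mp ht.1])
    · filter_upwards [hσ, hle, hst] with t h2 h3 ht
      have h4 := mem_polydisk.mp h2 j
      have h5 := mem_unitDisk.mp ht.1
      rw [div_le_iff₀ (by linarith)]
      have h6 := norm_sub_le_of_norm_diskMap_le (h3 j).1 h4 (norm_diskMap_lt (h3 j).1 h4) le_rfl
      rwa [norm_mul (leftInv x (σ t)) (x j), hj, mul_one] at h6

/-- Difference quotients of `f` at the boundary value `τ` have the same limit along
pseudohyperbolically asymptotic families of points. -/
theorem tendsto_of_tendsto_diskMap {n : ℕ} {f : (Fin n → ℂ) → ℂ}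
    (hf : DifferentiableOn ℂ f (polydisk n)) (hmaps : MapsTo f (polydisk n) unitDisk) {τ : ℂ}
    (hτ : ‖τ‖ = 1) {ι : Type*} {l : Filter ι} {z w : ι → Fin n → ℂ}
    (hz : ∀ᶠ i in l, z i ∈ polydisk n) (hw : ∀ᶠ i in l, w i ∈ polydisk n)
    (hd : ∀ j, Tendsto (fun i => diskMap (w i j) (z i j)) l (𝓝 0)) {D : ι → ℂ} {L : ℂ}
    (hL : Tendsto (fun i => (τ - f (w i)) / D i) l (𝓝 L)) :
    Tendsto (fun i => (τ - f (z i)) / D i) l (𝓝 L) := by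
  set ρ : ι → ℝ := fun i => ‖fun j => diskMap (w i j) (z i j)‖ with hρ
  have hρ0 : Tendsto ρ l (𝓝 0) := by
    have h1 : Tendsto (fun i => fun j => diskMap (w i j) (z i j)) l (𝓝 0) :=
      tendsto_pi_nhds.mpr hd
    simpa using h1.norm
  have h1 : Tendsto (fun i => 2 * ρ i / (1 - ρ i) * ‖(τ - f (w i)) / D i‖) l (𝓝 0) := by
    have h2 := ((hρ0.const_mul 2).div (hρ0.const_sub 1) (by simp)).mul hL.norm
    simpa using h2
  have h3 : Tendsto (fun i => (f (z i) - f (w i)) / D i) l (𝓝 0) := by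
    refine squeeze_zero_norm' ?_ h1
    filter_upwards [hz, hw, hρ0.eventually_lt_const zero_lt_one] with i hzi hwi hρi
    have h4 := norm_sub_le_of_norm_diskMap_le (mem_unitDisk.mp (hmaps hwi))
      (mem_unitDisk.mp (hmaps hzi)) hρi (norm_diskMap_map_le_pi hf hmaps hwi hzi)
    have h5 : 1 - ‖f (w i)‖ ≤ ‖τ - f (w i)‖ := hτ ▸ norm_sub_norm_le τ (f (w i))
    have h6 : 0 ≤ 2 * ρ i / (1 - ρ i) :=
      div_nonneg (mul_nonneg two_pos.le (norm_nonneg _)) (by linarith)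
    rw [norm_div, norm_div, ← mul_div_assoc]
    exact div_le_div_of_nonneg_right (h4.trans (mul_le_mul_of_nonneg_left h5 h6)) (norm_nonneg _)
  have h7 := hL.sub h3
  rw [sub_zero] at h7
  refine h7.congr fun i => ?_
  rw [← sub_div]
  congr 1
  ring

theorem tendsto_diskMap_of_norm_lt_one {ι : Type*} {l : Filter ι} {a b : ι → ℂ} {p : ℂ}
    (hp : ‖p‖ < 1) (ha : Tendsto a l (𝓝 p)) (hb : Tendsto b l (𝓝 p)) :
    Tendsto (fun i => diskMap (a i) (b i)) l (𝓝 0) := by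
  have h := (hb.sub ha).div (((Complex.continuous_conj.tendsto p).comp ha |>.mul hb).const_sub 1)
    (diskMap_den_ne hp hp)
  rw [sub_self, zero_div] at h
  exact h

theorem tendsto_diskMap_of_norm_sub_le {ι : Type*} {l : Filter ι} {a b : ι → ℂ} {s : ι → ℝ}
    (ha : ∀ᶠ i in l, ‖a i‖ < 1) (hs : Tendsto s l (𝓝 0))
    (h : ∀ᶠ i in l, ‖b i - a i‖ ≤ s i * (1 - ‖a i‖)) :
    Tendsto (fun i => diskMap (a i) (b i)) l (𝓝 0) := by
  refine squeeze_zero_norm' ?_ hs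
  filter_upwards [ha, h, hs.eventually_lt_const zero_lt_one] with i h1 h2 h3
  exact (norm_diskMap_le_of_norm_sub_le h1 h3 h2).2

/-! ### Directional derivatives -/

/-- Along a special restricted curve, the derivative of `f` in a direction `v` with `v_j = β_j x_j`
for `|x_j| = 1` converges, and its limit is determined by the angular derivatives `c` of `f` along
the disks `boundaryDisk x β δ`. -/
theorem exists_tendsto_dirDeriv {n : ℕ} {f : (Fin n → ℂ) → ℂ}
    (hf : DifferentiableOn ℂ f (polydisk n)) (hmaps : MapsTo f (polydisk n) unitDisk)
    {x : Fin n → ℂ} (hx : ‖x‖ = 1) {τ : ℂ} (hτ : ‖τ‖ = 1) {β : Fin n → ℝ}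
    (hβ : ∀ j, β j ∈ Icc (0 : ℝ) 1) {v : Fin n → ℂ} (hv : ∀ j, ‖x j‖ = 1 → v j = β j * x j)
    {c : ℝ → ℂ} (hcδ : ∀ δ ∈ Ico (0 : ℝ) 1, ∀ M : ℝ,
      Tendsto (fun η => (τ - f (boundaryDisk x β δ η)) / (1 - η))
        (𝓝[stolzRegion 1 M] 1) (𝓝 (c δ)))
    {σ : ℝ → Fin n → ℂ} (hσ : IsCurveTo x σ) (hs : IsSpecial x σ) (hr : IsRestricted x σ) :
    ∃ L : ℂ, Tendsto (fun t => dirDeriv f v (σ t)) (𝓝[<] 1) (𝓝 (-L)) ∧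
      Tendsto (fun δ : ℝ => (c δ - c 0) / δ) (𝓝[>] 0) (𝓝 L) := by
  obtain ⟨M, hM, hζS, hσp, hσd, hσe⟩ := exists_stolz_of_isSpecial hx hσ hs hr
  set ζ : ℝ → ℂ := fun t => leftInv x (σ t) with hζ
  have hζ1 : Tendsto ζ (𝓝[<] 1) (𝓝 1) := hζS.mono_right nhdsWithin_le_nhds
  have hζst : ∀ᶠ t in 𝓝[<] (1 : ℝ), ζ t ∈ stolzRegion 1 M :=
    hζS.eventually eventually_mem_nhdsWithin
  have hσj : ∀ j, Tendsto (fun t => σ t j) (𝓝[<] 1) (𝓝 (x j)) := tendsto_pi_nhds.mp hσ.2.2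
  have hxle : ∀ j, ‖x j‖ ≤ 1 := fun j => hx ▸ norm_le_pi_norm x j
  have hζx : ∀ j, Tendsto (fun t => ζ t * x j) (𝓝[<] 1) (𝓝 (x j)) := fun j => by
    simpa using hζ1.mul_const (x j)
  -- The perturbed curves, for a complex parameter `z`. The radius `r` of the parameter disk is so
  -- small that they stay within a bounded pseudohyperbolic distance of the geodesic.
  set p : ℝ → ℂ → Fin n → ℂ := fun t z => σ t + ((1 - ζ t) * z) • v with hp
  set V := ‖v‖ + 1 with hV
  have hV0 : 0 < V := by positivity
  set r := 1 / (4 * M * V) with hrdef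
  have hr0 : 0 < r := by positivity
  have hr1 : r < 1 := by
    rw [hrdef, div_lt_one (by positivity)]
    nlinarith [norm_nonneg v]
  have hpert : ∀ t, ∀ z ∈ ball (0 : ℂ) r, ∀ j, ‖(1 - ζ t) * z * v j‖ ≤ ‖1 - ζ t‖ * (r * V) :=
    fun t z hz j => by
      rw [norm_mul, norm_mul, mul_assoc]
      have h1 := (norm_le_pi_norm v j).trans (show ‖v‖ ≤ V by linarith)
      have h2 := (mem_ball_zero_iff.mp hz).le
      gcongr
  have hrV : r * V = 1 / (4 * M) := by rw [hrdef]; field_simp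
  have hclose : ∀ᶠ t in 𝓝[<] (1 : ℝ), ∀ j, ∀ z ∈ ball (0 : ℂ) r,
      ‖p t z j - ζ t * x j‖ ≤ 1 / 2 * (1 - ‖ζ t * x j‖) := by
    refine eventually_all.mpr fun j => ?_
    have hsplit : ∀ t z, p t z j - ζ t * x j = (σ t j - ζ t * x j) + (1 - ζ t) * z * v j :=
      fun t z => by simp only [hp, Pi.add_apply, Pi.smul_apply, smul_eq_mul]; ring
    rcases eq_or_lt_of_le (hxle j) with hj | hj
    · filter_upwards [(hσe j hj).eventually_lt_const (show (0 : ℝ) < 1 / 4 by norm_num), hζst]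
        with t h1 h2 z hz
      have h3 : 0 < 1 - ‖ζ t‖ := by linarith [mem_unitDisk.mp h2.1]
      have h4 := h2.2
      rw [div_lt_iff₀ h3] at h1 h4
      have h5 := hpert t z hz j
      have h6 : ‖1 - ζ t‖ * (r * V) ≤ 1 / 4 * (1 - ‖ζ t‖) := by
        rw [hrV, mul_one_div, div_le_iff₀ (by positivity)]
        linarith
      rw [hsplit, norm_mul (ζ t) (x j), hj, mul_one]
      exact (norm_add_le _ _).trans (by linarith)
    · have hL : Tendsto (fun t => ‖σ t j - ζ t * x j‖ + ‖1 - ζ t‖ * (r * V)) (𝓝[<] 1)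
          (𝓝 (‖x j - x j‖ + ‖1 - (1 : ℂ)‖ * (r * V))) :=
        ((hσj j).sub (hζx j)).norm.add ((hζ1.const_sub 1).norm.mul_const _)
      have hR : Tendsto (fun t => 1 / 2 * (1 - ‖ζ t * x j‖)) (𝓝[<] 1)
          (𝓝 (1 / 2 * (1 - ‖x j‖))) := ((hζx j).norm.const_sub 1).const_mul _
      filter_upwards [hL.eventually_lt hR (by simpa using hj)] with t h1 z hz
      rw [hsplit]
      exact (norm_add_le _ _).trans (by linarith [hpert t z hz j])
  have hζxd : ∀ᶠ t in 𝓝[<] (1 : ℝ), ∀ j, ‖ζ t * x j‖ < 1 := by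
    filter_upwards [hζst] with t ht j
    rw [norm_mul]
    exact (mul_le_of_le_one_right (norm_nonneg _) (hxle j)).trans_lt (mem_unitDisk.mp ht.1)
  have hpp : ∀ᶠ t in 𝓝[<] (1 : ℝ), ∀ z ∈ ball (0 : ℂ) r, p t z ∈ polydisk n ∧
      ‖fun j => diskMap (ζ t * x j) (p t z j)‖ ≤ 1 / 2 := by
    filter_upwards [hclose, hζxd] with t h1 h2 z hz
    have h3 := fun j => norm_diskMap_le_of_norm_sub_le (h2 j) (by norm_num) (h1 j z hz)
    exact ⟨mem_polydisk.mpr fun j => (h3 j).1,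
      (pi_norm_le_iff_of_nonneg (by norm_num)).mpr fun j => (h3 j).2⟩
  have hb0 : ∀ η : ℂ, boundaryDisk x β 0 η = fun j => η * x j := fun η => by
    ext j; simp [boundaryDisk]
  set h : ℝ → ℂ → ℂ := fun t z => (τ - f (p t z)) / (1 - ζ t) with hh
  have hpd : ∀ t, Differentiable ℂ (p t) := fun t => by simp only [hp]; fun_prop
  have hhd : ∀ᶠ t in 𝓝[<] (1 : ℝ), DifferentiableOn ℂ (h t) (ball 0 r) := by
    filter_upwards [hpp] with t h1
    exact ((hf.comp (hpd t).differentiableOn fun z hz => (h1 z hz).1).const_sub τ).div_const _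
  have hhK : ∀ᶠ t in 𝓝[<] (1 : ℝ), ∀ z ∈ ball (0 : ℂ) r, ‖h t z‖ ≤ 3 * (‖c 0‖ + 1) := by
    have h0 := ((hcδ 0 ⟨le_rfl, zero_lt_one⟩ M).comp hζS).norm.eventually_lt_const
      (lt_add_one ‖c 0‖)
    filter_upwards [hpp, hζxd, h0] with t h1 h2 h3 z hz
    simp only [Function.comp_apply, hb0] at h3
    have hw : (fun j => ζ t * x j) ∈ polydisk n := mem_polydisk.mpr h2
    have h4 := norm_sub_le_of_norm_diskMap_le (mem_unitDisk.mp (hmaps hw))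
      (mem_unitDisk.mp (hmaps (h1 z hz).1)) (by norm_num)
      ((norm_diskMap_map_le_pi hf hmaps hw (h1 z hz).1).trans (h1 z hz).2)
    have h5 : 1 - ‖f fun j => ζ t * x j‖ ≤ ‖τ - f fun j => ζ t * x j‖ := hτ ▸ norm_sub_norm_le τ _
    have h6 : ‖τ - f (p t z)‖ ≤ 3 * ‖τ - f fun j => ζ t * x j‖ := by
      have := norm_sub_le_norm_sub_add_norm_sub τ (f fun j => ζ t * x j) (f (p t z))
      rw [norm_sub_rev (f fun j => ζ t * x j)] at this
      norm_num at h4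
      linarith
    calc ‖h t z‖ = ‖τ - f (p t z)‖ / ‖1 - ζ t‖ := norm_div _ _
      _ ≤ 3 * ‖τ - f fun j => ζ t * x j‖ / ‖1 - ζ t‖ := by gcongr
      _ = 3 * ‖(τ - f fun j => ζ t * x j) / (1 - ζ t)‖ := by rw [norm_div, mul_div_assoc]
      _ ≤ _ := by linarith
  have hhc : ∀ δ ∈ Ico 0 r, Tendsto (fun t => h t (δ : ℂ)) (𝓝[<] 1) (𝓝 (c δ)) := by
    intro δ hδ
    have hδ' : δ ∈ Ico (0 : ℝ) 1 := ⟨hδ.1, hδ.2.trans hr1⟩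
    have hδb : (δ : ℂ) ∈ ball (0 : ℂ) r := by
      rw [mem_ball_zero_iff, Complex.norm_real, Real.norm_of_nonneg hδ.1]; exact hδ.2
    refine tendsto_of_tendsto_diskMap hf hmaps hτ (w := fun t => boundaryDisk x β δ (ζ t))
      (hpp.mono fun t ht => (ht _ hδb).1)
      (hζst.mono fun t ht => boundaryDisk_mem_polydisk hx hβ hδ' ht.1) (fun j => ?_)
      ((hcδ δ hδ' M).comp hζS)
    rcases eq_or_lt_of_le (hxle j) with hj | hj
    · have hs0 := (hσe j hj).div_const (1 - δ)
      rw [zero_div] at hs0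
      refine tendsto_diskMap_of_norm_sub_le (hζst.mono fun t ht => mem_polydisk.mp
        (boundaryDisk_mem_polydisk hx hβ hδ' ht.1) j) hs0 ?_
      filter_upwards [hζst] with t ht
      have h1 := le_one_sub_norm_boundaryDisk hx hβ hδ' (mem_unitDisk.mp ht.1) j
      have h2 : p t δ j - boundaryDisk x β δ (ζ t) j = σ t j - ζ t * x j := by
        simp only [hp, boundaryDisk, Pi.add_apply, Pi.smul_apply, smul_eq_mul, hv j hj]
        push_cast
        ring
      have h3 : 0 < 1 - ‖ζ t‖ := by linarith [mem_unitDisk.mp ht.1]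
      have h4 : 0 < 1 - δ := by linarith [hδ'.2]
      rw [h2]
      calc ‖σ t j - ζ t * x j‖ = ‖σ t j - ζ t * x j‖ / (1 - ‖ζ t‖) / (1 - δ) *
            ((1 - δ) * (1 - ‖ζ t‖)) := by field_simp
        _ ≤ _ := mul_le_mul_of_nonneg_left h1 (by positivity)
    · refine tendsto_diskMap_of_norm_lt_one hj ?_ ?_
      · have := ((differentiable_boundaryDisk (x := x) (β := β) (δ := δ)).continuous.tendsto 1).comp
          hζ1
        simpa [boundaryDisk] using tendsto_pi_nhds.mp this j
      · have := (hσj j).add (((hζ1.const_sub 1).mul_const (δ : ℂ)).mul_const (v j))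
        simpa [hp] using this
  obtain ⟨L, hL1, hL2⟩ := exists_tendsto_deriv hr0 hhd hhK hhc
  refine ⟨L, hL1.neg.congr' ?_, hL2⟩
  filter_upwards [hσp, hζst] with t ht hζt
  have hne := one_sub_ne_zero_of_mem_unitDisk hζt.1
  have hp0 : p t 0 = σ t := by simp [hp]
  have hfd : HasFDerivAt f (fderiv ℂ f (σ t)) (p t 0) := by
    rw [hp0]
    exact (hf.differentiableAt (isOpen_ball.mem_nhds ht)).hasFDerivAt
  have hpd0 : HasDerivAt (p t) ((1 - ζ t) • v) 0 := by
    have h1 := (((hasDerivAt_id' (0 : ℂ)).const_mul (1 - ζ t)).smul_const v).const_add (σ t)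
    rwa [mul_one] at h1
  have h2 := ((hfd.comp_hasDerivAt (0 : ℂ) hpd0).const_sub τ).div_const (1 - ζ t)
  have h3 : deriv (h t) 0 = _ := h2.deriv
  rw [h3, map_smul, smul_eq_mul, dirDeriv]
  field_simp

/-! ### Restricted limits -/

section Limits

variable {n : ℕ} {f : (Fin n → ℂ) → ℂ} {x : Fin n → ℂ} {τ : ℂ} {α : ℝ}

theorem hasRestrictedKLimit_dirDeriv (hf : DifferentiableOn ℂ f (polydisk n))
    (hmaps : MapsTo f (polydisk n) unitDisk) (hx : ‖x‖ = 1) (hτ : ‖τ‖ = 1) {β : Fin n → ℝ}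
    (hβ : ∀ j, β j ∈ Icc (0 : ℝ) 1) {v : Fin n → ℂ} (hv : ∀ j, ‖x j‖ = 1 → v j = β j * x j)
    {c : ℝ → ℂ} (hcδ : ∀ δ ∈ Ico (0 : ℝ) 1, ∀ M : ℝ,
      Tendsto (fun η => (τ - f (boundaryDisk x β δ η)) / (1 - η))
        (𝓝[stolzRegion 1 M] 1) (𝓝 (c δ)))
    {L : ℂ} (hL : Tendsto (fun δ : ℝ => (c δ - c 0) / δ) (𝓝[>] 0) (𝓝 (-L))) :
    HasRestrictedKLimit (dirDeriv f v) x L := fun σ hσ hs hr => by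
  obtain ⟨L', h1, h2⟩ := exists_tendsto_dirDeriv hf hmaps hx hτ hβ hv hcδ hσ hs hr
  rwa [tendsto_nhds_unique h2 hL, neg_neg] at h1

/-- In the directions `v` that agree with `x` in the components with `|x_j| = 1`, the derivative of
`f` has the same restricted `K`-limit as the difference quotient. -/
theorem hasRestrictedKLimit_dirDeriv_of_eq (hf : DifferentiableOn ℂ f (polydisk n))
    (hmaps : MapsTo f (polydisk n) unitDisk) (hx : ‖x‖ = 1) (hτ : ‖τ‖ = 1)
    (hg : ∀ M : ℝ, Tendsto (fun η : ℂ => (τ - f (η • x)) / (1 - η))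
      (𝓝[stolzRegion 1 M] 1) (𝓝 (α * τ)))
    {v : Fin n → ℂ} (hv : ∀ j, ‖x j‖ = 1 → v j = x j) :
    HasRestrictedKLimit (dirDeriv f v) x (α * τ) := by
  refine hasRestrictedKLimit_dirDeriv hf hmaps hx hτ (β := fun _ => 1)
    (c := fun δ => (1 - δ) * (α * τ)) (fun _ => ⟨zero_le_one, le_rfl⟩)
    (fun j hj => by simp [hv j hj]) (fun δ hδ M => ?_) ?_
  · -- The disk is the geodesic of `x`, reparametrized by a map that preserves Stolz regions.
    have h1 : Tendsto (fun η : ℂ => η + (1 - η) * (δ : ℂ)) (𝓝[stolzRegion 1 M] 1)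
        (𝓝[stolzRegion 1 M] 1) := by
      refine tendsto_nhdsWithin_iff.mpr ⟨?_, ?_⟩
      · have : Tendsto (fun η : ℂ => η + (1 - η) * (δ : ℂ)) (𝓝 1) (𝓝 (1 + (1 - 1) * (δ : ℂ))) :=
          Continuous.tendsto (by fun_prop) _
        rw [sub_self, zero_mul, add_zero] at this
        exact tendsto_nhdsWithin_of_tendsto_nhds this
      · filter_upwards [self_mem_nhdsWithin] with η hη
        have h2 := norm_add_one_sub_mul_le (η := η) hδ.1 hδ.2.le
        have h3 := mem_unitDisk.mp hη.1
        have h4 := hη.2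
        have h5 : 0 < 1 - δ := by linarith [hδ.2]
        have h6 : 0 < 1 - ‖η‖ := by linarith
        have h7 : (1 - δ) * (1 - ‖η‖) ≤ 1 - ‖η + (1 - η) * (δ : ℂ)‖ := by linarith
        have h8 : 0 < 1 - ‖η + (1 - η) * (δ : ℂ)‖ := (mul_pos h5 h6).trans_le h7
        refine ⟨mem_unitDisk.mpr (by linarith), ?_⟩
        rw [div_lt_iff₀ h6] at h4
        have hM : 0 < M := pos_of_mul_pos_left ((norm_nonneg _).trans_lt h4) h6.le
        have h9 : 1 - (η + (1 - η) * (δ : ℂ)) = ((1 - δ : ℝ) : ℂ) * (1 - η) := by push_cast; ring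
        rw [div_lt_iff₀ h8, h9, norm_mul, Complex.norm_real, Real.norm_of_nonneg h5.le]
        calc (1 - δ) * ‖1 - η‖ < (1 - δ) * (M * (1 - ‖η‖)) := by gcongr
          _ = M * ((1 - δ) * (1 - ‖η‖)) := by ring
          _ ≤ _ := mul_le_mul_of_nonneg_left h7 hM.le
    refine (((hg M).comp h1).const_mul (1 - (δ : ℂ))).congr' ?_
    filter_upwards [self_mem_nhdsWithin] with η hη
    have h2 := one_sub_ne_zero_of_mem_unitDisk hη.1
    have h3 : (1 : ℂ) - δ ≠ 0 := by
      rw [← Complex.ofReal_one, ← Complex.ofReal_sub]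
      exact_mod_cast (by linarith [hδ.2] : (1 - δ : ℝ) ≠ 0)
    have h4 : 1 - (η + (1 - η) * (δ : ℂ)) = (1 - δ) * (1 - η) := by ring
    have h5 : boundaryDisk x (fun _ => 1) δ η = (η + (1 - η) * (δ : ℂ)) • x := by
      ext j; simp [boundaryDisk]
    simp only [Function.comp_apply]
    rw [h4, h5]
    field_simp
  · refine tendsto_const_nhds.congr' ?_
    filter_upwards [self_mem_nhdsWithin] with δ hδ
    have : (δ : ℂ) ≠ 0 := by exact_mod_cast (ne_of_gt hδ)
    simp only [Complex.ofReal_zero]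
    field_simp
    ring

theorem hasRestrictedKLimit_dirDeriv_of_eq_zero (hf : DifferentiableOn ℂ f (polydisk n))
    (hmaps : MapsTo f (polydisk n) unitDisk) (hx : ‖x‖ = 1) (hτ : ‖τ‖ = 1)
    (hg : ∀ M : ℝ, Tendsto (fun η : ℂ => (τ - f (η • x)) / (1 - η))
      (𝓝[stolzRegion 1 M] 1) (𝓝 (α * τ)))
    {v : Fin n → ℂ} (hv : ∀ j, ‖x j‖ = 1 → v j = 0) :
    HasRestrictedKLimit (dirDeriv f v) x 0 := by
  refine hasRestrictedKLimit_dirDeriv hf hmaps hx hτ (β := fun _ => 0) (c := fun _ => α * τ)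
    (fun _ => ⟨le_rfl, zero_le_one⟩) (fun j hj => by simp [hv j hj]) (fun δ hδ M => ?_) (by simp)
  have h : ∀ η : ℂ, boundaryDisk x (fun _ => 0) δ η = η • x := fun η => by
    ext j; simp [boundaryDisk]
  simpa only [h] using hg M

theorem hasRestrictedKLimit_div_one_sub_leftInv (hf : DifferentiableOn ℂ f (polydisk n))
    (hmaps : MapsTo f (polydisk n) unitDisk) (hx : ‖x‖ = 1) (hτ : ‖τ‖ = 1)
    (hg : ∀ M : ℝ, Tendsto (fun η : ℂ => (τ - f (η • x)) / (1 - η))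
      (𝓝[stolzRegion 1 M] 1) (𝓝 (α * τ))) :
    HasRestrictedKLimit (fun z => (τ - f z) / (1 - leftInv x z)) x (α * τ) :=
  fun σ hσ hs hr => by
  obtain ⟨M, -, hζ, hp, hd, -⟩ := exists_stolz_of_isSpecial hx hσ hs hr
  refine tendsto_of_tendsto_diskMap hf hmaps hτ (w := fun t => leftInv x (σ t) • x) hp ?_ hd
    ((hg M).comp hζ)
  filter_upwards [hζ.eventually eventually_mem_nhdsWithin] with t ht
  rw [polydisk, mem_ball_zero_iff, norm_smul, hx, mul_one]
  exact mem_unitDisk.mp ht.1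

theorem hasRestrictedKLimit_div_sub (hx : ‖x‖ = 1)
    (h : HasRestrictedKLimit (fun z => (τ - f z) / (1 - leftInv x z)) x (α * τ)) {j : Fin n}
    (hj : ‖x j‖ = 1) : HasRestrictedKLimit (fun z => (τ - f z) / (x j - z j)) x
      (α * τ * (starRingEnd ℂ) (x j)) := fun σ hσ hs hr => by
  obtain ⟨M, -, hζ, hp, -, he⟩ := exists_stolz_of_isSpecial hx hσ hs hr
  have hst := hζ.eventually eventually_mem_nhdsWithin
  have hxj : x j ≠ 0 := norm_ne_zero_iff.mp (by rw [hj]; exact one_ne_zero)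
  have h1 : Tendsto (fun t => (σ t j - leftInv x (σ t) * x j) / (1 - leftInv x (σ t))) (𝓝[<] 1)
      (𝓝 0) := by
    refine squeeze_zero_norm' ?_ (he j hj)
    filter_upwards [hst] with t ht
    have h2 := mem_unitDisk.mp ht.1
    have h3 : 1 - ‖leftInv x (σ t)‖ ≤ ‖1 - leftInv x (σ t)‖ := by
      simpa using norm_sub_norm_le 1 (leftInv x (σ t))
    rw [norm_div]
    exact div_le_div_of_nonneg_left (norm_nonneg _) (by linarith) h3
  have h2 := (h σ hσ hs hr).div (h1.const_sub (x j)) (by simpa using hxj)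
  have e : α * τ / (x j - 0) = α * τ * (starRingEnd ℂ) (x j) := by
    have h3 := Complex.mul_conj' (x j)
    rw [hj] at h3
    rw [sub_zero, div_eq_iff hxj, mul_assoc, mul_comm _ (x j), h3]
    simp
  rw [e] at h2
  refine h2.congr' ?_
  filter_upwards [hst] with t ht
  have h3 := one_sub_ne_zero_of_mem_unitDisk ht.1
  have h4 : x j - (σ t j - leftInv x (σ t) * x j) / (1 - leftInv x (σ t)) =
      (x j - σ t j) / (1 - leftInv x (σ t)) := by field_simp; ring
  simp only [Pi.div_apply]
  rw [h4, div_div_div_cancel_right₀ h3]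

theorem isCurveTo_radial (hx : ‖x‖ = 1) : IsCurveTo x fun t : ℝ => (t : ℂ) • x := by
  refine ⟨by fun_prop, fun t ht => ?_, ?_⟩
  · rw [polydisk, mem_ball_zero_iff, norm_smul, hx, mul_one, Complex.norm_real,
      Real.norm_of_nonneg ht.1]
    exact ht.2
  · have : Tendsto (fun t : ℝ => (t : ℂ) • x) (𝓝 1) (𝓝 (((1 : ℝ) : ℂ) • x)) :=
      Continuous.tendsto (by fun_prop) _
    rw [Complex.ofReal_one, one_smul] at this
    exact tendsto_nhdsWithin_of_tendsto_nhds this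

theorem isPeculiar_radial (hx : ‖x‖ = 1) : IsPeculiar x fun t : ℝ => (t : ℂ) • x := by
  intro R hR
  have h1 : ∀ᶠ t : ℝ in 𝓝[<] 1, 1 - t < R * (1 + t) := by
    refine nhdsWithin_le_nhds ((Continuous.continuousAt (by fun_prop)).eventually_lt
      (Continuous.continuousAt (by fun_prop)) ?_)
    linarith
  filter_upwards [h1, Ioo_mem_nhdsLT (zero_lt_one (α := ℝ))] with t ht ht'
  have h2 : ‖(t : ℂ)‖ = t := by rw [Complex.norm_real, Real.norm_of_nonneg ht'.1.le]
  have h3 : ‖1 - (t : ℂ)‖ = 1 - t := by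
    rw [← Complex.ofReal_one, ← Complex.ofReal_sub, Complex.norm_real,
      Real.norm_of_nonneg (by linarith [ht'.2])]
  have h4 : boundaryDisk x (fun _ => 0) 0 t = (t : ℂ) • x := by ext j; simp [boundaryDisk]
  rw [← h4]
  refine boundaryDisk_mem_horosphere hx (fun _ => ⟨le_rfl, zero_le_one⟩) ⟨le_rfl, zero_lt_one⟩
    (mem_unitDisk.mpr (h2.trans_lt ht'.2)) ?_
  rw [h2, h3]
  nlinarith [mul_lt_mul_of_pos_left ht (sub_pos.mpr ht'.2)]

theorem leftInv_smul_self (hx : ‖x‖ = 1) (a : ℂ) : leftInv x (a • x) = a := by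
  have h : leftInv x (a • x) = a * leftInv x x := by
    simp only [leftInv, Pi.smul_apply, smul_eq_mul, mul_assoc, ← Finset.mul_sum]
    ring
  rw [h, leftInv_self hx, mul_one]

theorem isSpecial_radial (hx : ‖x‖ = 1) : IsSpecial x fun t : ℝ => (t : ℂ) • x := by
  refine tendsto_const_nhds.congr' ?_
  filter_upwards [Ico_mem_nhdsLT (zero_lt_one (α := ℝ))] with t ht
  have h1 : (t : ℂ) • x ∈ polydisk n := (isCurveTo_radial hx).2.1 ht
  rw [retraction, geodesic, leftInv_smul_self hx, kobayashiDist_polydisk h1 h1]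
  simp [poincareDist, diskMap]

theorem isRestricted_radial (hx : ‖x‖ = 1) : IsRestricted x fun t : ℝ => (t : ℂ) • x := by
  refine ⟨2, one_lt_two, ?_⟩
  simpa only [leftInv_smul_self hx] using
    tendsto_ofReal_stolzRegion.eventually eventually_mem_nhdsWithin

/-- For a single component with `|x_j| = 1` the limit is not known in advance: it is the one-sided
derivative in `δ` of the angular derivatives along `boundaryDisk x (Pi.single j 1) δ`. -/
theorem exists_hasRestrictedKLimit_dirDeriv_single (hf : DifferentiableOn ℂ f (polydisk n))
    (hmaps : MapsTo f (polydisk n) unitDisk) (hx : ‖x‖ = 1) (hτ : ‖τ‖ = 1)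
    (hJ : ∀ R : ℝ, 0 < R → ∀ z ∈ horosphere x R, ‖τ - f z‖ ^ 2 ≤ α * R * (1 - ‖f z‖ ^ 2))
    {j : Fin n} (hj : ‖x j‖ = 1) :
    ∃ L : ℂ, HasRestrictedKLimit (dirDeriv f (Pi.single j 1)) x L := by
  have hβ : ∀ k, (Pi.single j 1 : Fin n → ℝ) k ∈ Icc (0 : ℝ) 1 := fun k => by
    rcases eq_or_ne k j with rfl | hk
    · simp
    · simp [hk]
  have hxj : x j ≠ 0 := norm_ne_zero_iff.mp (by rw [hj]; exact one_ne_zero)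
  have hex : ∀ δ : ℝ, ∃ c : ℂ, δ ∈ Ico (0 : ℝ) 1 → ∀ M : ℝ,
      Tendsto (fun η => (τ - f (boundaryDisk x (Pi.single j 1) δ η)) / (1 - η))
        (𝓝[stolzRegion 1 M] 1) (𝓝 c) := fun δ => by
    by_cases hδ : δ ∈ Ico (0 : ℝ) 1
    · obtain ⟨c, -, -, hc⟩ := exists_angular_derivative_boundaryDisk hf hmaps hx hτ hJ hβ hδ
      exact ⟨_, fun _ => hc⟩
    · exact ⟨0, fun h => absurd h hδ⟩
  choose c hc using hex
  have hv : ∀ k, ‖x k‖ = 1 → (Pi.single j (x j) : Fin n → ℂ) k =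
      ((Pi.single j 1 : Fin n → ℝ) k : ℂ) * x k := fun k _ => by
    rcases eq_or_ne k j with rfl | hk
    · simp
    · simp [hk]
  have hcurve := fun σ => exists_tendsto_dirDeriv hf hmaps hx hτ hβ hv hc (σ := σ)
  -- The radial curve shows that `c` is differentiable at `0`.
  obtain ⟨L, -, hL⟩ := hcurve _ (isCurveTo_radial hx) (isSpecial_radial hx) (isRestricted_radial hx)
  have hK : HasRestrictedKLimit (dirDeriv f (Pi.single j (x j))) x (-L) :=
    hasRestrictedKLimit_dirDeriv hf hmaps hx hτ hβ hv hc (by rwa [neg_neg])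
  refine ⟨(x j)⁻¹ * -L, fun σ h1 h2 h3 => ((hK σ h1 h2 h3).const_mul (x j)⁻¹).congr fun t => ?_⟩
  have e : (Pi.single j (x j) : Fin n → ℂ) = x j • Pi.single j 1 := by
    rw [← Pi.single_smul, smul_eq_mul, mul_one]
  rw [e, dirDeriv, map_smul, smul_eq_mul, inv_mul_cancel_left₀ hxj, dirDeriv]

theorem hasRestrictedELimit_of_julia
    (hJ : ∀ R : ℝ, 0 < R → ∀ z ∈ horosphere x R, ‖τ - f z‖ ^ 2 ≤ α * R * (1 - ‖f z‖ ^ 2))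
    (hmaps : MapsTo f (polydisk n) unitDisk) : HasRestrictedELimit f x τ := fun σ _ hp => by
  rw [Metric.tendsto_nhds]
  intro ε hε
  have hR : 0 < ε ^ 2 / (|α| + 1) := by positivity
  filter_upwards [hp _ hR] with t ht
  have h1 := hJ _ hR _ ht
  have h2 := mem_unitDisk.mp (hmaps ht.1)
  rw [dist_comm, dist_eq_norm]
  refine lt_of_pow_lt_pow_left₀ 2 hε.le ?_
  have h3 : 0 < 1 - ‖f (σ t)‖ ^ 2 := by nlinarith [norm_nonneg (f (σ t))]
  have h4 : 1 - ‖f (σ t)‖ ^ 2 ≤ 1 := by nlinarith [norm_nonneg (f (σ t))]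
  calc ‖τ - f (σ t)‖ ^ 2 ≤ α * (ε ^ 2 / (|α| + 1)) * (1 - ‖f (σ t)‖ ^ 2) := h1
    _ ≤ |α| * (ε ^ 2 / (|α| + 1)) * 1 := by gcongr; exact le_abs_self α
    _ < ε ^ 2 := by
      rw [mul_one, ← mul_div_assoc, div_lt_iff₀ (by positivity)]
      nlinarith [pow_pos hε 2]

end Limits

theorem theorem4p1 {n : ℕ} (f : (Fin n → ℂ) → ℂ) (hf : DifferentiableOn ℂ f (polydisk n))
    (hmaps : MapsTo f (polydisk n) unitDisk) (x : Fin n → ℂ) (hx : x ∈ frontier (polydisk n))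
    (α : ℝ)
    (hα : liminf (fun w => (((1 - ‖f w‖) / (1 - ‖w‖) : ℝ) : EReal)) (𝓝[polydisk n] x) =
      (α : EReal)) :
    ∃ τ : ℂ, ‖τ‖ = 1 ∧ (∀ L : ℂ, HasRestrictedELimit f x L ↔ L = τ) ∧
      HasRestrictedKLimit (fun z => (τ - f z) / (1 - leftInv x z)) x (α * τ) ∧
      (∀ j, ‖x j‖ = 1 →
        HasRestrictedKLimit (fun z => (τ - f z) / (x j - z j)) x
          (α * τ * (starRingEnd ℂ) (x j))) ∧
      HasRestrictedKLimit (dirDeriv f x) x (α * τ) ∧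
      HasRestrictedKLimit (dirDeriv f (silovPart x)) x (α * τ) ∧
      (∀ j, ‖x j‖ < 1 → HasRestrictedKLimit (dirDeriv f (Pi.single j 1)) x 0) ∧
      (∀ j, ‖x j‖ = 1 → ∃ L : ℂ, HasRestrictedKLimit (dirDeriv f (Pi.single j 1)) x L) := by
  have hx1 : ‖x‖ = 1 := by
    rwa [polydisk, frontier_ball (0 : Fin n → ℂ) one_ne_zero, mem_sphere_zero_iff_norm] at hx
  obtain ⟨τ, hτ, hJ⟩ := exists_julia hf hmaps hx1 hα
  have hg := tendsto_geodesic hf hmaps hx1 hτ hα hJ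
  have hE := hasRestrictedELimit_of_julia hJ hmaps
  have hK := hasRestrictedKLimit_div_one_sub_leftInv hf hmaps hx1 hτ hg
  refine ⟨τ, hτ, fun L => ⟨fun hL => ?_, fun hL => hL ▸ hE⟩, hK,
    fun j hj => hasRestrictedKLimit_div_sub hx1 hK hj,
    hasRestrictedKLimit_dirDeriv_of_eq hf hmaps hx1 hτ hg fun _ _ => rfl,
    hasRestrictedKLimit_dirDeriv_of_eq hf hmaps hx1 hτ hg fun j hj => if_pos hj,
    fun j hj => hasRestrictedKLimit_dirDeriv_of_eq_zero hf hmaps hx1 hτ hg fun k hk => ?_,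
    fun j hj => exists_hasRestrictedKLimit_dirDeriv_single hf hmaps hx1 hτ hJ hj⟩
  · exact tendsto_nhds_unique (hL _ (isCurveTo_radial hx1) (isPeculiar_radial hx1))
      (hE _ (isCurveTo_radial hx1) (isPeculiar_radial hx1))
  · exact Pi.single_eq_of_ne (fun h => by rw [h] at hk; exact hj.ne hk) _
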